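/- Let $\mathcal P_n$ be the $n$-qubit Pauli group, i.e. the group of all $c\,\sigma_1\otimes\cdots\otimes\sigma_n$ with $c\in\{\pm1,\pm i\}$ and $\sigma_j\in\{I,X,Y,Z\}$. For $n$-qubit gates (unitary operators on $(\mathbb C^2)^{\otimes n}$) define $\mathcal C_1=\mathcal P_n$ and $\mathcal C_{k+1}=\{U : U\,\mathcal P_n\,U^\dagger\subseteq\mathcal C_k\}$ for $k\ge 1$; in particular $\mathcal C_2$ is the Clifford group. Call an $n$-qubit gate $U$ semi-Clifford if there is a maximal abelian subgroup $G$ of $\mathcal P_n$ such that $UGU^\dagger$ is also a maximal abelian subgroup of $\mathcal P_n$. Theorem 1. For $n=1$ and $n=2$ and every $k\ge 1$, every $n$-qubit gate in $\mathcal C_k$ is semi-Clifford. Moreover, for $n=1$ the gates are classified as follows. Let $S_k=\mathrm{diag}(1,e^{2\pi i/2^k})$. For every $k\ge 2$, $$\mathcal C_k=\{L_1S_k^{m}L_2 : L_1,L_2\in\mathcal C_2,\ m\in\mathbb N\},$$ and for every $k\ge 3$, $$\mathcal C_k\setminus\mathcal C_{k-1}=\{L_1S_k^{m}L_2 : L_1,L_2\in\mathcal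 C_2,\ m\in\mathbb N\text{ odd}\}.$$ -/

import Mathlib

/-- The `n`-qubit gates: unitary operators on `(ℂ²)^{⊗ n}`, written as matrices in the computational
basis, whose vectors are labelled by the bit strings `Fin n → Fin 2`. -/
abbrev QGate (n : ℕ) : Type :=
  Matrix.unitaryGroup (Fin n → Fin 2) ℂ

/-- The four one-qubit Pauli matrices `I, X, Y, Z`, in this order. -/
noncomputable def pauliMatrix : Fin 4 → Matrix (Fin 2) (Fin 2) ℂ :=
  ![!![1, 0; 0, 1], !![0, 1; 1, 0], !![0, -Complex.I; Complex.I, 0], !![1, 0; 0, -1]]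

/-- The tensor product `A 0 ⊗ A 1 ⊗ ⋯ ⊗ A (n - 1)` of one-qubit operators. -/
noncomputable def tensorMatrix {n : ℕ} (A : Fin n → Matrix (Fin 2) (Fin 2) ℂ) :
    Matrix (Fin n → Fin 2) (Fin n → Fin 2) ℂ :=
  Matrix.of fun x y => ∏ i, A i (x i) (y i)

theorem tensorMatrix_mul {n : ℕ} (A B : Fin n → Matrix (Fin 2) (Fin 2) ℂ) :
    tensorMatrix A * tensorMatrix B = tensorMatrix fun i => A i * B i := by
  ext x y
  simp only [tensorMatrix, Matrix.mul_apply, Matrix.of_apply]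
  rw [Finset.prod_univ_sum]
  simp [Finset.prod_mul_distrib]

theorem tensorMatrix_smul {n : ℕ} (c : Fin n → ℂ) (A : Fin n → Matrix (Fin 2) (Fin 2) ℂ) :
    (tensorMatrix fun i => c i • A i) = (∏ i, c i) • tensorMatrix A := by
  ext x y
  simp [tensorMatrix, Finset.prod_mul_distrib]

theorem tensorMatrix_one {n : ℕ} :
    (tensorMatrix fun _ : Fin n => (1 : Matrix (Fin 2) (Fin 2) ℂ)) = 1 := by
  ext x y
  by_cases h : x = y
  · subst h
    simp [tensorMatrix]
  · obtain ⟨i, hi⟩ := Function.ne_iff.mp h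
    rw [Matrix.one_apply_ne h]
    simp only [tensorMatrix, Matrix.of_apply]
    exact Finset.prod_eq_zero (Finset.mem_univ i) (Matrix.one_apply_ne hi)

theorem tensorMatrix_star {n : ℕ} (A : Fin n → Matrix (Fin 2) (Fin 2) ℂ) :
    star (tensorMatrix A) = tensorMatrix fun i => star (A i) := by
  ext x y
  simp [tensorMatrix, Matrix.star_apply]

theorem pauliMatrix_star (a : Fin 4) : star (pauliMatrix a) = pauliMatrix a := by
  ext x y
  fin_cases a <;> fin_cases x <;> fin_cases y <;> simp [pauliMatrix, Matrix.star_apply]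

theorem pauliMatrix_mul (a b : Fin 4) :
    ∃ (c : ℂ) (d : Fin 4), c ^ 4 = 1 ∧ pauliMatrix a * pauliMatrix b = c • pauliMatrix d := by
  have key : ∀ c : ℂ, c ∈ ({1, Complex.I, -Complex.I} : Set ℂ) → c ^ 4 = 1 := by
    rintro c (rfl | rfl | rfl)
    · simp
    · exact Complex.I_pow_four
    · rw [neg_pow, Complex.I_pow_four]
      norm_num
  fin_cases a <;> fin_cases b
  · exact ⟨1, 0, key _ (by simp), by simp [pauliMatrix]⟩
  · exact ⟨1, 1, key _ (by simp), by simp [pauliMatrix]⟩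
  · exact ⟨1, 2, key _ (by simp), by simp [pauliMatrix]⟩
  · exact ⟨1, 3, key _ (by simp), by simp [pauliMatrix]⟩
  · exact ⟨1, 1, key _ (by simp), by simp [pauliMatrix]⟩
  · exact ⟨1, 0, key _ (by simp), by simp [pauliMatrix]⟩
  · exact ⟨Complex.I, 3, key _ (by simp), by simp [pauliMatrix]⟩
  · exact ⟨-Complex.I, 2, key _ (by simp), by simp [pauliMatrix]⟩
  · exact ⟨1, 2, key _ (by simp), by simp [pauliMatrix]⟩
  · exact ⟨-Complex.I, 3, key _ (by simp), by simp [pauliMatrix]⟩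
  · exact ⟨1, 0, key _ (by simp), by simp [pauliMatrix]⟩
  · exact ⟨Complex.I, 1, key _ (by simp), by simp [pauliMatrix]⟩
  · exact ⟨1, 3, key _ (by simp), by simp [pauliMatrix]⟩
  · exact ⟨Complex.I, 2, key _ (by simp), by simp [pauliMatrix]⟩
  · exact ⟨-Complex.I, 1, key _ (by simp), by simp [pauliMatrix]⟩
  · exact ⟨1, 0, key _ (by simp), by simp [pauliMatrix]⟩

/-- The `n`-qubit Pauli group: all `c • (σ₁ ⊗ ⋯ ⊗ σₙ)` with `c ∈ {1, i, -1, -i}` and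
`σⱼ ∈ {I, X, Y, Z}`. -/
noncomputable def pauliGroup (n : ℕ) : Subgroup (QGate n) where
  carrier := {U | ∃ (c : ℂ) (s : Fin n → Fin 4), c ^ 4 = 1 ∧
    (U : Matrix (Fin n → Fin 2) (Fin n → Fin 2) ℂ) = c • tensorMatrix fun i => pauliMatrix (s i)}
  one_mem' := by
    refine ⟨1, fun _ => 0, by simp, ?_⟩
    have h : pauliMatrix 0 = 1 := by
      simp [pauliMatrix, Matrix.one_fin_two]
    simp [h, tensorMatrix_one]
  mul_mem' := by
    rintro U V ⟨c, s, hc, hU⟩ ⟨d, t, hd, hV⟩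
    choose e u he h using fun i => pauliMatrix_mul (s i) (t i)
    refine ⟨c * d * ∏ i, e i, u, ?_, ?_⟩
    · rw [mul_pow, mul_pow, hc, hd, ← Finset.prod_pow]
      simp [he]
    · rw [Submonoid.coe_mul, hU, hV, Matrix.smul_mul, Matrix.mul_smul, tensorMatrix_mul]
      simp only [h]
      rw [tensorMatrix_smul, smul_smul, smul_smul, mul_assoc]
  inv_mem' := by
    rintro U ⟨c, s, hc, hU⟩
    refine ⟨star c, s, ?_, ?_⟩
    · rw [← star_pow, hc, star_one]
    · rw [Matrix.UnitaryGroup.inv_val, hU, star_smul, tensorMatrix_star]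
      simp only [pauliMatrix_star]

/-- The sets `𝒞_k` of `n`-qubit gates, `k ≥ 1`: `𝒞_1` is the Pauli group, and `𝒞_{k+1}` consists of
the gates `U` with `U 𝒞_1 U† ⊆ 𝒞_k`. There is no level `0`; that value is a placeholder. -/
def gateHierarchy (n : ℕ) : ℕ → Set (QGate n)
  | 0 => ∅
  | 1 => pauliGroup n
  | k + 2 => {U | ∀ P ∈ pauliGroup n, U * P * U⁻¹ ∈ gateHierarchy n (k + 1)}

/-- `G` is a maximal abelian subgroup of the `n`-qubit Pauli group. -/
def IsMaximalAbelianPauli {n : ℕ} (G : Subgroup (QGate n)) : Prop :=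
  Maximal (fun H : Subgroup (QGate n) =>
    H ≤ pauliGroup n ∧ ∀ a ∈ H, ∀ b ∈ H, a * b = b * a) G

/-- `U` is semi-Clifford: there is a maximal abelian subgroup `G` of the Pauli group such that
`U G U†` is again a maximal abelian subgroup of the Pauli group. -/
def IsSemiClifford {n : ℕ} (U : QGate n) : Prop :=
  ∃ G : Subgroup (QGate n), IsMaximalAbelianPauli G ∧
    IsMaximalAbelianPauli (G.map (MulAut.conj U).toMonoidHom)

/-- The one-qubit phase gate `S_k = diag(1, exp(2πi / 2^k))`. -/
noncomputable def phaseGate (k : ℕ) : QGate 1 :=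
  ⟨Matrix.diagonal fun x =>
      if x 0 = 0 then 1 else Complex.exp ((2 * Real.pi / 2 ^ k : ℝ) * Complex.I), by
    rw [Matrix.mem_unitaryGroup_iff, Matrix.star_eq_conjTranspose, Matrix.diagonal_conjTranspose,
      Matrix.diagonal_mul_diagonal, ← Matrix.diagonal_one]
    congr 1
    funext x
    rw [Pi.star_apply]
    split_ifs
    · simp
    · rw [Complex.star_def, Complex.mul_conj, Complex.normSq_eq_norm_sq,
        Complex.norm_exp_ofReal_mul_I]
      simp⟩

/-!
The proof replaces a gate `U` by the matrix `R(U)` of a small unitary representation in which Pauli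
gates act diagonally.

For one qubit this is conjugation on the span of `X, Y, Z` (dimension three). For two qubits it is
`A ↦ U A Uᵀ` on the antisymmetric operators, with the six antisymmetric Pauli strings `γ_a` as basis;
up to phases every Pauli gate is some `γ_a γ_b†`, and for `a ≠ b` it acts by changing the signs of
`γ_a` and `γ_b`. This is the covering `SU(4) → SO(6)`.

For two qubits, induction on the level shows that each column of `R(U)` has at most two nonzero
entries (`card_columnSupport_rep_le_two`). If `U` has level `k + 1`, then `M = R(U P U⁻¹)` has this
property for the Pauli gate `P = γ_a γ_b†`, and `M = 1 - 2 Π` with `Π` the projection onto the span of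
the columns `a`, `b` of `R(U)`. As `M` is Hermitian, unitary, sparse and of trace `2`, its diagonal
entries other than `±1` cancel in pairs, so `1` occurs on the diagonal exactly two times more often
than `-1` (`trace_eq_card_sub_card`). Hence any two columns of `R(U)` together meet at most four rows,
and fewer if their span contains a coordinate vector; a double count then bounds every column
(`card_columnSupport_le_two`). A unitary matrix that is sparse in this sense is block diagonal with
blocks of size two, up to a permutation (`exists_perm_involution`), so the three Pauli gates attached
to the pairs of columns are sent to multiples of the three attached to the pairs of rows. Together
with the scalars, such triples generate maximal abelian subgroups (`isSelfCentralizing_pairingSet`).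

For one qubit the same induction shows that some column of `R(U)` has a single nonzero entry
(`exists_rep_column_eq_single`), so `U` sends one of `X, Y, Z` to a multiple of another. Clifford gates
move both to `Z`, and `U` becomes diagonal (`exists_clifford_mul_diagGate_mul_clifford`). Conjugating
`X` by `diag(1, z)` gives `diag(1, z⁻²)` up to Clifford factors, so `diag(1, z)` has level `k ≥ 2` if
and only if `z ^ 2 ^ k = 1` (`diagGate_mem_gateHierarchy_iff`), and the classification follows.
-/

/-! ### Pauli strings -/

theorem pauliMatrix_mul_self (a : Fin 4) : pauliMatrix a * pauliMatrix a = 1 := by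
  fin_cases a <;> simp [pauliMatrix, Matrix.one_fin_two]

theorem pauliMatrix_trace_mul (a b : Fin 4) :
    (pauliMatrix a * pauliMatrix b).trace = if a = b then 2 else 0 := by
  fin_cases a <;> fin_cases b <;> simp [pauliMatrix, Matrix.trace_fin_two] <;> norm_num

theorem pauliMatrix_completeness (i j k l : Fin 2) :
    ∑ a, pauliMatrix a i j * pauliMatrix a k l = if i = l ∧ j = k then 2 else 0 := by
  fin_cases i <;> fin_cases j <;> fin_cases k <;> fin_cases l <;>
    simp [pauliMatrix, Fin.sum_univ_four] <;> norm_num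

theorem pauliMatrix_transpose (a : Fin 4) :
    (pauliMatrix a).transpose = (if a = 2 then -1 else 1 : ℂ) • pauliMatrix a := by
  ext i j
  fin_cases a <;> fin_cases i <;> fin_cases j <;> simp [pauliMatrix]

/-- The sign in the commutation rule of two Pauli matrices. -/
def pauliSign (a b : Fin 4) : ℤ :=
  if a = 0 ∨ b = 0 ∨ a = b then 1 else -1

theorem pauliMatrix_mul_comm (a b : Fin 4) :
    pauliMatrix a * pauliMatrix b = (pauliSign a b : ℂ) • (pauliMatrix b * pauliMatrix a) := by
  fin_cases a <;> fin_cases b <;> simp [pauliMatrix, pauliSign]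

theorem exists_pauliMatrix_mul_eq_xor (a b : Fin 4) :
    ∃ c : ℂ, c ≠ 0 ∧ pauliMatrix a * pauliMatrix b = c • pauliMatrix (a ^^^ b) := by
  refine ⟨!![1, 1, 1, 1; 1, 1, Complex.I, -Complex.I; 1, -Complex.I, 1, Complex.I;
    1, Complex.I, -Complex.I, 1] a b, ?_, ?_⟩
  · fin_cases a <;> fin_cases b <;> simp
  · have h : ∀ a b : Fin 4, a ^^^ b = !![0, 1, 2, 3; 1, 0, 3, 2; 2, 3, 0, 1; 3, 2, 1, 0] a b := by
      intro a b
      fin_cases a <;> fin_cases b <;> rfl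
    rw [h]
    fin_cases a <;> fin_cases b <;> simp [pauliMatrix]

theorem tensorMatrix_trace {n : ℕ} (A : Fin n → Matrix (Fin 2) (Fin 2) ℂ) :
    (tensorMatrix A).trace = ∏ i, (A i).trace := by
  simp only [Matrix.trace, Matrix.diag, tensorMatrix, Matrix.of_apply]
  rw [Finset.prod_univ_sum]
  simp

theorem tensorMatrix_transpose {n : ℕ} (A : Fin n → Matrix (Fin 2) (Fin 2) ℂ) :
    (tensorMatrix A).transpose = tensorMatrix fun i => (A i).transpose := by
  ext x y
  simp [tensorMatrix]

/-- The Pauli string `σ_{s 0} ⊗ ⋯ ⊗ σ_{s (n - 1)}`. -/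
noncomputable def pauliString {n : ℕ} (s : Fin n → Fin 4) :
    Matrix (Fin n → Fin 2) (Fin n → Fin 2) ℂ :=
  tensorMatrix fun i => pauliMatrix (s i)

theorem pauliString_zero {n : ℕ} : pauliString (0 : Fin n → Fin 4) = 1 := by
  have h : pauliMatrix 0 = 1 := by simp [pauliMatrix, Matrix.one_fin_two]
  simp [pauliString, h, tensorMatrix_one]

theorem pauliString_star {n : ℕ} (s : Fin n → Fin 4) : star (pauliString s) = pauliString s := by
  simp [pauliString, tensorMatrix_star, pauliMatrix_star]

theorem pauliString_mul_self {n : ℕ} (s : Fin n → Fin 4) :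
    pauliString s * pauliString s = 1 := by
  simp [pauliString, tensorMatrix_mul, pauliMatrix_mul_self, tensorMatrix_one]

theorem pauliString_trace_mul {n : ℕ} (s t : Fin n → Fin 4) :
    (pauliString s * pauliString t).trace = if s = t then 2 ^ n else 0 := by
  rw [pauliString, pauliString, tensorMatrix_mul, tensorMatrix_trace]
  simp only [pauliMatrix_trace_mul]
  split_ifs with h
  · simp [h]
  · obtain ⟨i, hi⟩ := Function.ne_iff.mp h
    exact Finset.prod_eq_zero (Finset.mem_univ i) (if_neg hi)

theorem pauliString_transpose {n : ℕ} (s : Fin n → Fin 4) :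
    (pauliString s).transpose = ((∏ i, if s i = 2 then -1 else 1 : ℤ) : ℂ) • pauliString s := by
  rw [pauliString, tensorMatrix_transpose, Int.cast_prod, ← tensorMatrix_smul]
  simp [pauliMatrix_transpose]

theorem pauliString_mul_comm {n : ℕ} (s t : Fin n → Fin 4) :
    pauliString s * pauliString t =
      ((∏ i, pauliSign (s i) (t i) : ℤ) : ℂ) • (pauliString t * pauliString s) := by
  rw [pauliString, pauliString, tensorMatrix_mul, tensorMatrix_mul, Int.cast_prod,
    ← tensorMatrix_smul]
  simp only [← pauliMatrix_mul_comm]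

theorem exists_pauliString_mul_eq_xor {n : ℕ} (s t : Fin n → Fin 4) :
    ∃ c : ℂ, c ≠ 0 ∧ pauliString s * pauliString t = c • pauliString fun i => s i ^^^ t i := by
  choose c hc h using fun i => exists_pauliMatrix_mul_eq_xor (s i) (t i)
  refine ⟨∏ i, c i, Finset.prod_ne_zero_iff.mpr fun i _ => hc i, ?_⟩
  rw [pauliString, pauliString, tensorMatrix_mul, pauliString, ← tensorMatrix_smul]
  simp only [h]

/-- The Pauli strings form an orthogonal basis for the trace inner product. -/
theorem eq_sum_pauliString {n : ℕ} (A : Matrix (Fin n → Fin 2) (Fin n → Fin 2) ℂ) :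
    A = ∑ s : Fin n → Fin 4, ((2 ^ n)⁻¹ * (pauliString s * A).trace) • pauliString s := by
  have key : ∀ x y z w : Fin n → Fin 2,
      ∑ s : Fin n → Fin 4, pauliString s x y * pauliString s z w =
        if x = w ∧ y = z then 2 ^ n else 0 := by
    intro x y z w
    have h := Finset.prod_univ_sum (fun _ : Fin n => (Finset.univ : Finset (Fin 4)))
      (fun i a => pauliMatrix a (x i) (y i) * pauliMatrix a (z i) (w i))
    rw [Fintype.piFinset_univ] at h
    simp only [pauliString, tensorMatrix, Matrix.of_apply, ← Finset.prod_mul_distrib]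
    rw [← h]
    simp only [pauliMatrix_completeness]
    split_ifs with hxy
    · simp [hxy.1, hxy.2]
    · have : ∃ i, ¬ (x i = w i ∧ y i = z i) := by
        by_contra! hcon
        exact hxy ⟨funext fun i => (hcon i).1, funext fun i => (hcon i).2⟩
      obtain ⟨i, hi⟩ := this
      exact Finset.prod_eq_zero (Finset.mem_univ i) (if_neg hi)
  ext z w
  have hn : (2 ^ n : ℂ) ≠ 0 := pow_ne_zero n two_ne_zero
  symm
  calc (∑ s : Fin n → Fin 4, ((2 ^ n)⁻¹ * (pauliString s * A).trace) • pauliString s) z w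
      = (2 ^ n)⁻¹ * ∑ x, ∑ y, A y x *
          ∑ s : Fin n → Fin 4, pauliString s x y * pauliString s z w := by
        simp only [Matrix.sum_apply, Matrix.smul_apply, smul_eq_mul, Matrix.trace,
          Matrix.diag, Matrix.mul_apply, Finset.mul_sum, Finset.sum_mul]
        rw [Finset.sum_comm]
        refine Finset.sum_congr rfl fun x _ => ?_
        rw [Finset.sum_comm]
        exact Finset.sum_congr rfl fun y _ => Finset.sum_congr rfl fun s _ => by ring
    _ = A z w := by
        simp only [key]
        rw [Finset.sum_eq_single w, Finset.sum_eq_single z]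
        · simp only [and_self, if_true]
          field_simp
        · intro y _ hy
          simp [hy]
        · simp
        · intro x _ hx
          simp [hx]
        · simp

/-! ### The Pauli group -/

theorem qGate_coe_ne_zero {n : ℕ} (U : QGate n) : U.1 ≠ 0 := by
  intro h
  have := Matrix.mem_unitaryGroup_iff.mp U.2
  rw [h, Matrix.zero_mul] at this
  exact zero_ne_one this

theorem mem_pauliGroup_iff {n : ℕ} {U : QGate n} :
    U ∈ pauliGroup n ↔ ∃ (c : ℂ) (s : Fin n → Fin 4), c ^ 4 = 1 ∧
      (U : Matrix (Fin n → Fin 2) (Fin n → Fin 2) ℂ) = c • pauliString s :=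
  Iff.rfl

theorem pow_four_of_mem_pauliGroup {n : ℕ} {U : QGate n} (hU : U ∈ pauliGroup n) : U ^ 4 = 1 := by
  obtain ⟨c, s, hc, h⟩ := hU
  refine Subtype.ext ?_
  rw [SubmonoidClass.coe_pow, h, smul_pow, hc, one_smul, pow_succ, pow_succ, pow_two]
  change pauliString s * pauliString s * pauliString s * pauliString s = 1
  simp [pauliString_mul_self]

theorem mem_pauliGroup_of_eq_smul {n : ℕ} {U V : QGate n} {c : ℂ} (hV : V ∈ pauliGroup n)
    (hU : U ^ 4 = 1) (h : (U : Matrix (Fin n → Fin 2) (Fin n → Fin 2) ℂ) = c • V.1) :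
    U ∈ pauliGroup n := by
  have hc : c ^ 4 = 1 := by
    have h4 : (U ^ 4).1 = c ^ 4 • (V ^ 4).1 := by
      rw [SubmonoidClass.coe_pow, SubmonoidClass.coe_pow, h, smul_pow]
    rw [hU, pow_four_of_mem_pauliGroup hV] at h4
    have := congrFun (congrFun h4 0) 0
    simpa using this.symm
  obtain ⟨d, s, hd, h'⟩ := hV
  exact ⟨c * d, s, by rw [mul_pow, hc, hd, one_mul], by rw [h, h', smul_smul]⟩

/-- The Pauli string `s`, multiplied by a fourth root of unity, as a gate. -/
noncomputable def pauliGate {n : ℕ} (c : ℂ) (hc : c ^ 4 = 1) (s : Fin n → Fin 4) : QGate n :=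
  ⟨c • pauliString s, by
    have h1 : ‖c‖ = 1 
      := Complex.norm_eq_one_of_pow_eq_one hc (by norm_num)
    have h2 : c * star c = 1 := by
      rw [Complex.star_def, Complex.mul_conj, Complex.normSq_eq_norm_sq, h1]
      norm_num
    rw [Matrix.mem_unitaryGroup_iff, star_smul, pauliString_star, Matrix.smul_mul, Matrix.mul_smul,
      pauliString_mul_self, smul_smul, h2, one_smul]⟩

theorem pauliGate_mem {n : ℕ} (c : ℂ) (hc : c ^ 4 = 1) (s : Fin n → Fin 4) :
    pauliGate c hc s ∈ pauliGroup n :=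
  ⟨c, s, hc, rfl⟩

instance finite_pauliGroup (n : ℕ) : Finite (pauliGroup n) := by
  have h4 : {c : ℂ | c ^ 4 = 1}.Finite := by
    refine Set.Finite.subset (Polynomial.nthRoots 4 (1 : ℂ)).toFinset.finite_toSet fun c hc => ?_
    simpa [Polynomial.mem_nthRoots] using hc
  have : {U : Matrix (Fin n → Fin 2) (Fin n → Fin 2) ℂ |
      ∃ (c : ℂ) (s : Fin n → Fin 4), c ^ 4 = 1 ∧ U = c • pauliString s}.Finite := by
    refine ((h4.prod (Set.finite_univ (α := Fin n → Fin 4))).image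
      fun p => p.1 • pauliString p.2).subset ?_
    rintro U ⟨c, s, hc, rfl⟩
    exact ⟨(c, s), ⟨hc, trivial⟩, rfl⟩
  exact Set.Finite.preimage (f := (Subtype.val : QGate n → _)) Subtype.val_injective.injOn this

/-! ### Clifford gates and the hierarchy -/

theorem mem_gateHierarchy_one {n : ℕ} {U : QGate n} :
    U ∈ gateHierarchy n 1 ↔ U ∈ pauliGroup n :=
  Iff.rfl

theorem mem_gateHierarchy_add_two {n k : ℕ} {U : QGate n} :
    U ∈ gateHierarchy n (k + 2) ↔
      ∀ P ∈ pauliGroup n, U * P * U⁻¹ ∈ gateHierarchy n (k + 1) :=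
  Iff.rfl

theorem mem_gateHierarchy_two {n : ℕ} {U : QGate n} :
    U ∈ gateHierarchy n 2 ↔ U ∈ Subgroup.normalizer (pauliGroup n : Set (QGate n)) :=
  ⟨fun h =>
    have : Finite (pauliGroup n : Set (QGate n)) := finite_pauliGroup n
    Subgroup.mem_normalizer_fintype h, fun h P hP => (h P).mp hP⟩

theorem conj_mem_gateHierarchy_of_normalizer {n k : ℕ} {L U : QGate n}
    (hL : L ∈ Subgroup.normalizer (pauliGroup n : Set (QGate n)))
    (hU : U ∈ gateHierarchy n (k + 1)) :
    L * U * L⁻¹ ∈ gateHierarchy n (k + 1) := by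
  induction k generalizing U with
  | zero => exact (hL U).mp hU
  | succ k ih =>
    intro P hP
    have hP' : L⁻¹ * P * L ∈ pauliGroup n := by
      have := (inv_mem hL P).mp hP
      rwa [inv_inv] at this
    have := ih (hU _ hP')
    convert this using 1
    group

/-- Left multiplication by a Clifford gate preserves each level beyond the first. -/
theorem clifford_mul_mem {n k : ℕ} {L U : QGate n}
    (hL : L ∈ Subgroup.normalizer (pauliGroup n : Set (QGate n)))
    (hU : U ∈ gateHierarchy n (k + 2)) :
    L * U ∈ gateHierarchy n (k + 2) := by
  intro P hP
  have := conj_mem_gateHierarchy_of_normalizer hL (hU P hP)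
  convert this using 1
  group

/-- Right multiplication by a Clifford gate preserves each level beyond the first. -/
theorem mul_clifford_mem {n k : ℕ} {L U : QGate n}
    (hL : L ∈ Subgroup.normalizer (pauliGroup n : Set (QGate n)))
    (hU : U ∈ gateHierarchy n (k + 2)) :
    U * L ∈ gateHierarchy n (k + 2) := by
  intro P hP
  have := hU _ ((hL P).mp hP)
  convert this using 1
  group

/-! ### A criterion for semi-Clifford gates -/

/-- A commuting set of Pauli gates which, up to scalars, contains every Pauli gate commuting with
all of its elements. -/
structure IsSelfCentralizing {n : ℕ} (S : Set (QGate n)) : Prop where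
  mem_pauliGroup : ∀ s ∈ S, s ∈ pauliGroup n
  comm : ∀ s ∈ S, ∀ t ∈ S, s * t = t * s
  exists_eq_smul : ∀ p ∈ pauliGroup n, (∀ s ∈ S, s * p = p * s) → ∃ c : ℂ, ∃ s ∈ S, p.1 = c • s.1

/-- The subgroup of the Pauli gates commuting with all elements of `S`. -/
noncomputable def pauliCentralizer {n : ℕ} (S : Set (QGate n)) : Subgroup (QGate n) :=
  pauliGroup n ⊓ Subgroup.centralizer S

theorem mem_pauliCentralizer {n : ℕ} {S : Set (QGate n)} {p : QGate n} :
    p ∈ pauliCentralizer S ↔ p ∈ pauliGroup n ∧ ∀ s ∈ S, s * p = p * s := by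
  simp [pauliCentralizer, Subgroup.mem_inf, Subgroup.mem_centralizer_iff]

theorem mul_comm_of_eq_smul {n : ℕ} {p s t : QGate n} {c : ℂ} (hp : p.1 = c • s.1)
    (h : t * s = s * t) : t * p = p * t := by
  apply Subtype.ext
  have h' := congrArg Subtype.val h
  simp only [Submonoid.coe_mul] at h' ⊢
  rw [hp, Matrix.mul_smul, Matrix.smul_mul, h']

theorem IsSelfCentralizing.isMaximalAbelianPauli {n : ℕ} {S : Set (QGate n)}
    (hS : IsSelfCentralizing S) : IsMaximalAbelianPauli (pauliCentralizer S) := by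
  refine ⟨⟨inf_le_left, fun a ha b hb => ?_⟩, fun H hH hle x hx => ?_⟩
  · rw [mem_pauliCentralizer] at ha hb
    obtain ⟨c, s, hs, h⟩ := hS.exists_eq_smul b hb.1 hb.2
    exact mul_comm_of_eq_smul h (ha.2 s hs).symm
  · refine mem_pauliCentralizer.mpr ⟨hH.1 hx, fun s hs => ?_⟩
    exact hH.2 s (hle (mem_pauliCentralizer.mpr
      ⟨hS.mem_pauliGroup s hs, fun t ht => hS.comm t ht s hs⟩)) x hx

theorem IsSelfCentralizing.conj_mem_pauliCentralizer {n : ℕ} {S S' : Set (QGate n)}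
    (hS : IsSelfCentralizing S) (hS' : IsSelfCentralizing S') {U : QGate n}
    (h : ∀ s ∈ S, ∃ c : ℂ, ∃ s' ∈ S', (U * s * U⁻¹).1 = c • s'.1) {p : QGate n}
    (hp : p ∈ pauliCentralizer S) : U * p * U⁻¹ ∈ pauliCentralizer S' := by
  rw [mem_pauliCentralizer] at hp
  obtain ⟨c, s, hs, hps⟩ := hS.exists_eq_smul p hp.1 hp.2
  obtain ⟨d, s', hs', hss'⟩ := h s hs
  have key : (U * p * U⁻¹).1 = (c * d) • s'.1 := by
    rw [mul_smul, ← hss']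
    simp only [Submonoid.coe_mul, hps, Matrix.mul_smul, Matrix.smul_mul]
  refine mem_pauliCentralizer.mpr
    ⟨mem_pauliGroup_of_eq_smul (hS'.mem_pauliGroup s' hs') ?_ key, fun t ht =>
      mul_comm_of_eq_smul key (hS'.comm t ht s' hs')⟩
  rw [conj_pow, pow_four_of_mem_pauliGroup hp.1]
  group

/-- A gate matching two self-centralizing sets up to scalars is semi-Clifford. -/
theorem IsSelfCentralizing.isSemiClifford {n : ℕ} {S S' : Set (QGate n)}
    (hS : IsSelfCentralizing S) (hS' : IsSelfCentralizing S') {U : QGate n}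
    (h : ∀ s ∈ S, ∃ c : ℂ, ∃ s' ∈ S', (U * s * U⁻¹).1 = c • s'.1)
    (h' : ∀ s' ∈ S', ∃ c : ℂ, ∃ s ∈ S, (U⁻¹ * s' * U).1 = c • s.1) : IsSemiClifford U := by
  refine ⟨pauliCentralizer S, hS.isMaximalAbelianPauli, ?_⟩
  have heq : (pauliCentralizer S).map (MulAut.conj U).toMonoidHom = pauliCentralizer S' := by
    ext x
    constructor
    · rintro ⟨p, hp, rfl⟩
      exact hS.conj_mem_pauliCentralizer hS' h hp
    · intro hx
      have h2 := hS'.conj_mem_pauliCentralizer (U := U⁻¹) hS (by simpa using h') hx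
      refine ⟨_, h2, ?_⟩
      simp [mul_assoc]
  rw [heq]
  exact hS'.isMaximalAbelianPauli

/-! ### Matrix representations on Pauli frames -/

/-- A family of distinct Pauli strings with phases `coeff a`, whose span is preserved by the twisted
conjugations `A ↦ U A κ(U)⁻¹`. -/
structure PauliFrame (n : ℕ) (ι : Type) where
  /-- the labels of the Pauli strings -/
  index : ι → Fin n → Fin 4
  /-- the phases of the Pauli strings -/
  coeff : ι → ℂ
  /-- the twist -/
  twist : QGate n →* QGate n
  index_injective : Function.Injective index
  coeff_pow_four : ∀ a, coeff a ^ 4 = 1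
  trace_eq_zero : ∀ (U : QGate n) (a : ι) (s : Fin n → Fin 4), s ∉ Set.range index →
    (pauliString s * (U.1 *
      (coeff a • pauliString (index a)) * ((twist U)⁻¹ : QGate n).1)).trace = 0

namespace PauliFrame

variable {n : ℕ} {ι : Type} (F : PauliFrame n ι)

/-- The Pauli gates that make up the frame. -/
noncomputable def gate (a : ι) : QGate n :=
  pauliGate (F.coeff a) (F.coeff_pow_four a) (F.index a)

theorem gate_mem (a : ι) : F.gate a ∈ pauliGroup n :=
  pauliGate_mem _ _ _

theorem coe_gate (a : ι) : (F.gate a).1 = F.coeff a • pauliString (F.index a) :=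
  rfl

theorem star_coeff_mul_coeff (a : ι) : star (F.coeff a) * F.coeff a = 1 := by
  have h1 : ‖F.coeff a‖ = 1 := Complex.norm_eq_one_of_pow_eq_one (F.coeff_pow_four a) (by norm_num)
  rw [mul_comm, Complex.star_def, Complex.mul_conj, Complex.normSq_eq_norm_sq, h1]
  norm_num

theorem star_gate (a : ι) : star (F.gate a).1 = star (F.coeff a) • pauliString (F.index a) := by
  rw [coe_gate, star_smul, pauliString_star]

/-- The matrix of the twisted conjugation by `U` in the basis given by the frame. -/
noncomputable def rep (U : QGate n) : Matrix ι ι ℂ :=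
  Matrix.of fun b a => (2 ^ n)⁻¹ *
    (star (F.gate b).1 * (U * F.gate a * (F.twist U)⁻¹ : QGate n).1).trace

theorem rep_inv (U : QGate n) : F.rep U⁻¹ = star (F.rep U) := by
  ext b a
  rw [Matrix.star_apply, rep, rep, Matrix.of_apply, Matrix.of_apply, star_mul',
    ← Matrix.trace_conjTranspose]
  congr 1
  · simp
  · simp only [Submonoid.coe_mul, map_inv, inv_inv, Matrix.UnitaryGroup.inv_val,
      Matrix.conjTranspose_mul, Matrix.star_eq_conjTranspose, Matrix.conjTranspose_conjTranspose]
    rw [← Matrix.mul_assoc, Matrix.trace_mul_comm]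
    simp only [Matrix.mul_assoc]

theorem trace_star_gate_mul_gate [DecidableEq ι] (a b : ι) :
    (2 ^ n)⁻¹ * (star (F.gate b).1 * (F.gate a).1).trace = if b = a then 1 else 0 := by
  rw [star_gate, coe_gate, Matrix.smul_mul, Matrix.mul_smul, Matrix.trace_smul, Matrix.trace_smul,
    pauliString_trace_mul]
  simp only [F.index_injective.eq_iff]
  split_ifs with h
  · subst h
    rw [smul_smul, star_coeff_mul_coeff, one_smul]
    exact inv_mul_cancel₀ (pow_ne_zero n two_ne_zero)
  · simp

variable [Fintype ι]

theorem conj_gate (U : QGate n) (a : ι) :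
    (U * F.gate a * (F.twist U)⁻¹ : QGate n).1 = ∑ b, F.rep U b a • (F.gate b).1 := by
  rw [eq_sum_pauliString (U * F.gate a * (F.twist U)⁻¹ : QGate n).1]
  have h0 : ∀ s ∉ Finset.univ.image F.index, ((2 ^ n)⁻¹ * (pauliString s *
      (U * F.gate a * (F.twist U)⁻¹ : QGate n).1).trace) • pauliString s = 0 := by
    intro s hs
    have h := F.trace_eq_zero U a s (by simpa using hs)
    have h2 : (pauliString s * (U * F.gate a * (F.twist U)⁻¹ : QGate n).1).trace = 0 := h
    rw [h2, mul_zero, zero_smul]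
  rw [← Finset.sum_subset (Finset.subset_univ (Finset.univ.image F.index)) fun s _ hs => h0 s hs,
    Finset.sum_image fun x _ y _ hxy => F.index_injective hxy]
  refine Finset.sum_congr rfl fun b _ => ?_
  rw [rep, Matrix.of_apply, star_gate, coe_gate]
  generalize (U * F.gate a * (F.twist U)⁻¹ : QGate n).1 = A
  rw [Matrix.smul_mul, Matrix.trace_smul, smul_smul, smul_eq_mul]
  congr 1
  linear_combination (-((2 ^ n)⁻¹ * (pauliString (F.index b) * A).trace)) *
    F.star_coeff_mul_coeff b

variable [DecidableEq ι]

theorem rep_apply_of_eq_sum {U : QGate n} {a : ι} {r : ι → ℂ}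
    (h : (U * F.gate a * (F.twist U)⁻¹ : QGate n).1 = ∑ b, r b • (F.gate b).1) (b : ι) :
    F.rep U b a = r b := by
  rw [rep, Matrix.of_apply, h, Matrix.mul_sum, Matrix.trace_sum, Finset.mul_sum]
  simp only [Matrix.mul_smul, Matrix.trace_smul, smul_eq_mul, mul_left_comm _ (r _),
    trace_star_gate_mul_gate]
  simp

theorem rep_eq_diagonal {U : QGate n} {d : ι → ℂ}
    (h : ∀ a, (U * F.gate a * (F.twist U)⁻¹ : QGate n).1 = d a • (F.gate a).1) :
    F.rep U = Matrix.diagonal d := by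
  ext b a
  rw [F.rep_apply_of_eq_sum (r := fun b => Matrix.diagonal d b a)]
  rw [h, Finset.sum_eq_single a]
  · simp
  · intro b _ hb
    simp [Matrix.diagonal_apply_ne _ hb]
  · simp

theorem rep_one : F.rep 1 = 1 := by
  rw [← Matrix.diagonal_one]
  exact F.rep_eq_diagonal fun a => by simp

theorem rep_mul (U V : QGate n) : F.rep (U * V) = F.rep U * F.rep V := by
  ext c a
  refine F.rep_apply_of_eq_sum (r := fun c => (F.rep U * F.rep V) c a) ?_ c
  have h1 : (U * V * F.gate a * (F.twist (U * V))⁻¹ : QGate n).1 =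
      U.1 * (V * F.gate a * (F.twist V)⁻¹ : QGate n).1 * ((F.twist U)⁻¹ : QGate n).1 := by
    rw [map_mul, mul_inv_rev, ← Submonoid.coe_mul, ← Submonoid.coe_mul]
    congr 1
    group
  have h2 : ∀ b, U.1 * (F.gate b).1 * ((F.twist U)⁻¹ : QGate n).1 =
      ∑ c, F.rep U c b • (F.gate c).1 := fun b => F.conj_gate U b
  rw [h1, conj_gate, Matrix.mul_sum, Matrix.sum_mul]
  simp only [Matrix.mul_smul, Matrix.smul_mul, h2, Finset.smul_sum, smul_smul, Matrix.mul_apply,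
    Finset.sum_smul]
  rw [Finset.sum_comm]
  simp only [mul_comm]

theorem rep_mem_unitaryGroup (U : QGate n) : F.rep U ∈ Matrix.unitaryGroup ι ℂ := by
  rw [Matrix.mem_unitaryGroup_iff, ← rep_inv, ← rep_mul, mul_inv_cancel, rep_one]

end PauliFrame

/-! ### Unitary matrices with sparse columns -/

section SparseUnitary

variable {ι : Type} [Fintype ι] [DecidableEq ι]

/-- The set of rows in which column `a` has a nonzero entry. -/
noncomputable def columnSupport (R : Matrix ι ι ℂ) (a : ι) : Finset ι :=
  Finset.univ.filter fun i => R i a ≠ 0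

omit [DecidableEq ι] in
theorem mem_columnSupport {R : Matrix ι ι ℂ} {a i : ι} : i ∈ columnSupport R a ↔ R i a ≠ 0 := by
  simp [columnSupport]

theorem eq_or_eq_of_card_columnSupport_le_two {R : Matrix ι ι ℂ} {a i j k : ι}
    (h : (columnSupport R a).card ≤ 2) (hi : R i a ≠ 0) (hj : R j a ≠ 0) (hij : i ≠ j)
    (hk : R k a ≠ 0) : k = i ∨ k = j := by
  by_contra! hcon
  have hsub : ({k, i, j} : Finset ι) ⊆ columnSupport R a := by
    intro x hx
    simp only [Finset.mem_insert, Finset.mem_singleton] at hx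
    rcases hx with rfl | rfl | rfl <;> rwa [mem_columnSupport]
  have h3 : ({k, i, j} : Finset ι).card = 3 :=
    Finset.card_eq_three.mpr ⟨k, i, j, hcon.1, hcon.2, hij, rfl⟩
  have := Finset.card_le_card hsub
  omega

theorem sum_star_mul_of_mem_unitaryGroup {R : Matrix ι ι ℂ} (hR : R ∈ Matrix.unitaryGroup ι ℂ)
    (a b : ι) : ∑ k, star (R k a) * R k b = if a = b then 1 else 0 := by
  have h := congrFun (congrFun (Matrix.mem_unitaryGroup_iff'.mp hR) a) b
  rwa [Matrix.mul_apply, Matrix.one_apply] at h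

theorem sum_norm_sq_row {R : Matrix ι ι ℂ} (hR : R ∈ Matrix.unitaryGroup ι ℂ) (i : ι) :
    ∑ b, ‖R i b‖ ^ 2 = 1 := by
  have h := congrFun (congrFun (Matrix.mem_unitaryGroup_iff.mp hR) i) i
  rw [Matrix.mul_apply, Matrix.one_apply_eq] at h
  have h2 : ∀ b, R i b * star R b i = ((‖R i b‖ ^ 2 : ℝ) : ℂ) := fun b => by
    rw [Matrix.star_apply, Complex.star_def, Complex.mul_conj, Complex.normSq_eq_norm_sq]
  simp only [h2] at h
  exact_mod_cast h

/-- Two columns of a unitary matrix, one of which is supported on two rows, are orthogonal on these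
rows. -/
theorem star_mul_add_star_mul_eq_zero {R : Matrix ι ι ℂ} (hR : R ∈ Matrix.unitaryGroup ι ℂ)
    {a b i j : ι} (hab : a ≠ b) (hij : i ≠ j) (h : ∀ k, R k a ≠ 0 → k = i ∨ k = j) :
    star (R i a) * R i b + star (R j a) * R j b = 0 := by
  have h0 := sum_star_mul_of_mem_unitaryGroup hR a b
  rw [if_neg hab, ← Finset.sum_subset (Finset.subset_univ {i, j}), Finset.sum_pair hij] at h0
  · exact h0
  · intro k _ hk
    have : R k a = 0 := by
      by_contra hne
      exact hk (by simpa using h k hne)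
    simp [this]

/-- The nonzero diagonal entries other than `±1` of a Hermitian unitary matrix with at most two
nonzero entries in each column cancel in pairs. -/
theorem trace_eq_card_sub_card {M : Matrix ι ι ℂ} (hM : M ∈ Matrix.unitaryGroup ι ℂ)
    (hstar : star M = M) (hsupp : ∀ a, (columnSupport M a).card ≤ 2) :
    M.trace = (Finset.univ.filter fun i => M i i = 1).card -
      (Finset.univ.filter fun i => M i i = -1).card := by
  have hconj : ∀ i j, star (M i j) = M j i := fun i j => by
    rw [← Matrix.star_apply, hstar]
  have hex : ∀ i, M i i ≠ 1 → M i i ≠ -1 → ∃ j, j ≠ i ∧ M j i ≠ 0 := by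
    intro i h1 h2
    by_contra! hcon
    have h := sum_star_mul_of_mem_unitaryGroup hM i i
    rw [if_pos rfl, Finset.sum_eq_single i (fun j _ hj => by simp [hcon j hj]) (by simp),
      hconj] at h
    rcases mul_self_eq_one_iff.mp h with h | h
    exacts [h1 h, h2 h]
  have hneg : ∀ i j, j ≠ i → M i i ≠ 0 → M j i ≠ 0 → M i i + M j j = 0 := by
    intro i j hji hi hj
    have h := star_mul_add_star_mul_eq_zero hM hji.symm hji.symm fun k hk =>
      eq_or_eq_of_card_columnSupport_le_two (hsupp i) hi hj hji.symm hk
    rw [hconj, hconj] at h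
    have hij : M i j ≠ 0 := by
      rw [← hconj j i]
      exact star_ne_zero.mpr hj
    have : M i j * (M i i + M j j) = 0 := by linear_combination h
    exact (mul_eq_zero.mp this).resolve_left hij
  set s := Finset.univ.filter fun i => M i i ≠ 0 ∧ M i i ≠ 1 ∧ M i i ≠ -1 with hs
  have hmem : ∀ i, i ∈ s ↔ M i i ≠ 0 ∧ M i i ≠ 1 ∧ M i i ≠ -1 := by simp [hs]
  choose! g hg using hex
  have hg1 : ∀ i ∈ s, M i i + M (g i) (g i) = 0 := fun i hi => by
    rw [hmem] at hi
    have := hg i hi.2.1 hi.2.2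
    exact hneg i (g i) this.1 hi.1 this.2
  have hgs : ∀ i ∈ s, g i ∈ s := fun i hi => by
    have h := eq_neg_of_add_eq_zero_right (hg1 i hi)
    rw [hmem] at hi ⊢
    rw [h]
    exact ⟨neg_ne_zero.mpr hi.1, fun h' => hi.2.2 (by rw [← h', neg_neg]), fun h' =>
      hi.2.1 (neg_injective h')⟩
  have hsum : ∑ i ∈ s, M i i = 0 := by
    refine Finset.sum_involution (fun i _ => g i) hg1
      (fun i hi _ => (hg i ((hmem i).mp hi).2.1 ((hmem i).mp hi).2.2).1) hgs fun i hi => ?_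
    have h1 := hg i ((hmem i).mp hi).2.1 ((hmem i).mp hi).2.2
    have hj := (hmem _).mp (hgs i hi)
    have h2 := hg (g i) hj.2.1 hj.2.2
    have hij : M i (g i) ≠ 0 := by
      rw [← hconj (g i) i]
      exact star_ne_zero.mpr h1.2
    exact (eq_or_eq_of_card_columnSupport_le_two (hsupp (g i)) hij hj.1 h1.1.symm
      h2.2).resolve_right h2.1
  have hdiag : ∀ i, M i i = (if M i i = 1 then 1 else 0) - (if M i i = -1 then 1 else 0) +
      (if M i i ≠ 0 ∧ M i i ≠ 1 ∧ M i i ≠ -1 then M i i else 0) := by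
    intro i
    by_cases h1 : M i i = 1
    · norm_num [h1]
    · by_cases h2 : M i i = -1
      · norm_num [h2]
      · by_cases h0 : M i i = 0 <;> simp [h0, h1, h2]
  rw [Matrix.trace]
  simp only [Matrix.diag]
  rw [Finset.sum_congr rfl fun i _ => hdiag i, Finset.sum_add_distrib, Finset.sum_sub_distrib,
    ← Finset.sum_filter (fun i => M i i ≠ 0 ∧ M i i ≠ 1 ∧ M i i ≠ -1), hsum]
  simp

/-- In a unitary matrix of size six, if any two columns together meet at most four rows, and at most
three rows as soon as their span contains a coordinate vector, then every column has at most two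
nonzero entries. -/
theorem card_columnSupport_le_two {R : Matrix ι ι ℂ} (hR : R ∈ Matrix.unitaryGroup ι ℂ)
    (hι : Fintype.card ι = 6)
    (h4 : ∀ a b, a ≠ b → (columnSupport R a ∪ columnSupport R b).card ≤ 4)
    (h3 : ∀ a b i, a ≠ b → ‖R i a‖ ^ 2 + ‖R i b‖ ^ 2 = 1 →
      (columnSupport R a ∪ columnSupport R b).card ≤ 3) (a : ι) :
    (columnSupport R a).card ≤ 2 := by
  by_contra! hcon
  have hrow : ∀ i, ∃ b, R i b ≠ 0 := by
    intro i
    by_contra! hzero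
    simpa [hzero] using sum_norm_sq_row hR i
  have hsdiff : ∀ b, b ≠ a →
      (columnSupport R b \ columnSupport R a).card + (columnSupport R a).card ≤ 4 := fun b hb => by
    rw [Finset.card_sdiff_add_card]
    exact h4 b a hb
  have hcompl : (columnSupport R a)ᶜ.card = 6 - (columnSupport R a).card := by
    rw [Finset.card_compl, hι]
  obtain ⟨b₀, hb₀⟩ : ∃ b, b ≠ a := by
    have : Nontrivial ι := Fintype.one_lt_card_iff_nontrivial.mp (by omega)
    exact exists_ne a
  have hle := hsdiff b₀ hb₀
  -- a row `i` outside the support of column `a` meets some other column `b`, so this support has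
  -- exactly three elements
  have hcard : (columnSupport R a).card = 3 := by
    obtain ⟨i, hi⟩ : (columnSupport R a)ᶜ.Nonempty := Finset.card_pos.mp (by omega)
    obtain ⟨b, hb⟩ := hrow i
    have hba : b ≠ a := by
      rintro rfl
      exact Finset.mem_compl.mp hi (mem_columnSupport.mpr hb)
    have : 0 < (columnSupport R b \ columnSupport R a).card :=
      Finset.card_pos.mpr ⟨i, Finset.mem_sdiff.mpr
        ⟨mem_columnSupport.mpr hb, Finset.mem_compl.mp hi⟩⟩
    have := hsdiff b hba
    omega
  have htwo : ∀ i ∈ (columnSupport R a)ᶜ,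
      2 ≤ ((Finset.univ.erase a).filter fun b => R i b ≠ 0).card := by
    intro i hi
    have hia : R i a = 0 := by
      simpa [mem_columnSupport] using hi
    obtain ⟨b, hb⟩ := hrow i
    have hba : b ≠ a := by
      rintro rfl
      exact hb hia
    obtain ⟨c, hcb, hc⟩ : ∃ c, c ≠ b ∧ R i c ≠ 0 := by
      by_contra! hzero
      have hnorm := sum_norm_sq_row hR i
      rw [Finset.sum_eq_single b (fun c _ hc => by simp [hzero c hc]) (by simp)] at hnorm
      have h3' := h3 a b i hba.symm (by simp [hia, hnorm])
      have hsub : insert i (columnSupport R a) ⊆ columnSupport R a ∪ columnSupport R b := by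
        refine Finset.insert_subset ?_ Finset.subset_union_left
        exact Finset.mem_union_right _ (mem_columnSupport.mpr hb)
      have := Finset.card_le_card hsub
      rw [Finset.card_insert_of_notMem (Finset.mem_compl.mp hi)] at this
      omega
    have hca : c ≠ a := by
      rintro rfl
      exact hc hia
    have hsub : ({b, c} : Finset ι) ⊆ (Finset.univ.erase a).filter fun b => R i b ≠ 0 := by
      intro x hx
      simp only [Finset.mem_insert, Finset.mem_singleton] at hx
      rcases hx with rfl | rfl <;> simp [*]
    rw [← Finset.card_pair hcb.symm]
    exact Finset.card_le_card hsub
  have hone : ∀ b ∈ Finset.univ.erase a,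
      ((columnSupport R a)ᶜ.filter fun i => R i b ≠ 0).card ≤ 1 := by
    intro b hb
    have := hsdiff b (Finset.ne_of_mem_erase hb)
    have hsub : ((columnSupport R a)ᶜ.filter fun i => R i b ≠ 0) ⊆
        columnSupport R b \ columnSupport R a := by
      intro i hi
      simp only [Finset.mem_filter, Finset.mem_compl] at hi
      exact Finset.mem_sdiff.mpr ⟨mem_columnSupport.mpr hi.2, hi.1⟩
    have := Finset.card_le_card hsub
    omega
  have hdouble : ∑ i ∈ (columnSupport R a)ᶜ,
      ((Finset.univ.erase a).filter fun b => R i b ≠ 0).card =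
        ∑ b ∈ Finset.univ.erase a, ((columnSupport R a)ᶜ.filter fun i => R i b ≠ 0).card := by
    simp only [Finset.card_filter]
    exact Finset.sum_comm
  have hlow := Finset.card_nsmul_le_sum _ _ _ htwo
  have hup := Finset.sum_le_card_nsmul _ _ _ hone
  rw [Finset.card_erase_of_mem (Finset.mem_univ a), Finset.card_univ, hι] at hup
  rw [hdouble, hcompl, hcard] at hlow
  simp only [smul_eq_mul] at hlow hup
  omega

/-- An involution of a set with an even number of elements can be changed on its fixed points to
become free of fixed points. -/
theorem exists_fixedPointFree_involution_extending {α : Type} [Fintype α] [DecidableEq α]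
    (hα : Even (Fintype.card α)) (σ : α → α) (hσ : Function.Involutive σ) :
    ∃ π : α → α, Function.Involutive π ∧ (∀ a, π a ≠ a) ∧ ∀ a, σ a ≠ a → π a = σ a := by
  induction hm : (Finset.univ.filter fun a => σ a = a).card using Nat.strong_induction_on
    generalizing σ with
  | _ m ih =>
    by_cases hfree : ∀ a, σ a ≠ a
    · exact ⟨σ, hσ, hfree, fun _ _ => rfl⟩
    push Not at hfree
    obtain ⟨x, hx⟩ := hfree
    obtain ⟨y, hyx, hy⟩ : ∃ y, y ≠ x ∧ σ y = y := by
      by_contra! hcon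
      have hmod := Equiv.Perm.card_fixedPoints_modEq (f := (σ : Function.End α)) (p := 2) (n := 1)
        (funext fun a => hσ a)
      have hcard : Fintype.card (Function.fixedPoints σ) = 1 := by
        rw [Fintype.card_eq_one_iff]
        refine ⟨⟨x, hx⟩, fun z => Subtype.ext ?_⟩
        by_contra hz
        exact hcon z hz z.2
      rw [hcard] at hmod
      have : Fintype.card α % 2 = 0 := Nat.even_iff.mp hα
      rw [Nat.ModEq, this] at hmod
      norm_num at hmod
    let τ : α → α := fun a => if a = x then y else if a = y then x else σ a
    have hτx : τ x = y := by simp [τ]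
    have hτy : τ y = x := by simp [τ, hyx]
    have hτ : ∀ a, a ≠ x → a ≠ y → τ a = σ a := fun a h1 h2 => by simp [τ, h1, h2]
    have hinv : Function.Involutive τ := by
      intro a
      by_cases h1 : a = x
      · rw [h1, hτx, hτy]
      · by_cases h2 : a = y
        · rw [h2, hτy, hτx]
        · rw [hτ a h1 h2, hτ, hσ a]
          · intro h
            exact h1 (by rw [← hσ a, h, hx])
          · intro h
            exact h2 (by rw [← hσ a, h, hy])
    have hlt : (Finset.univ.filter fun a => τ a = a).card < m := by
      rw [← hm]
      refine Finset.card_lt_card (Finset.ssubset_iff_of_subset ?_ |>.mpr ⟨x, ?_, ?_⟩)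
      · intro a ha
        simp only [Finset.mem_filter, Finset.mem_univ, true_and] at ha ⊢
        by_cases h1 : a = x
        · rw [h1, hx]
        · by_cases h2 : a = y
          · rw [h2, hy]
          · rwa [← hτ a h1 h2]
      · simpa using hx
      · simpa [hτx] using hyx
    obtain ⟨π, hπ, hπfree, hext⟩ := ih _ hlt τ hinv rfl
    refine ⟨π, hπ, hπfree, fun a ha => ?_⟩
    have h1 : a ≠ x := fun h => ha (by rw [h, hx])
    have h2 : a ≠ y := fun h => ha (by rw [h, hy])
    rw [hext a (by rwa [hτ a h1 h2]), hτ a h1 h2]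

/-- A unitary matrix of even size with at most two nonzero entries in each column is, up to a
permutation of the rows, block diagonal with blocks of size two. -/
theorem exists_perm_involution {R : Matrix ι ι ℂ} (hR : R ∈ Matrix.unitaryGroup ι ℂ)
    (hι : Even (Fintype.card ι)) (hsupp : ∀ a, (columnSupport R a).card ≤ 2) :
    ∃ (s : Equiv.Perm ι) (π : ι → ι), Function.Involutive π ∧ (∀ a, π a ≠ a) ∧
      ∀ a b, R (s b) a ≠ 0 → b = a ∨ b = π a := by
  -- since the determinant is nonzero, some permutation selects nonzero entries
  obtain ⟨s, hs⟩ : ∃ s : Equiv.Perm ι, ∀ a, R (s a) a ≠ 0 := by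
    by_contra! hcon
    have hdet : R.det = 0 := by
      rw [Matrix.det_apply]
      refine Finset.sum_eq_zero fun s _ => ?_
      obtain ⟨a, ha⟩ := hcon s
      have hz : ∏ i, R (s i) i = 0 := Finset.prod_eq_zero (Finset.mem_univ a) ha
      rw [hz, smul_zero]
    have h1 := congrArg Matrix.det (Matrix.mem_unitaryGroup_iff.mp hR)
    rw [Matrix.det_mul, hdet, zero_mul, Matrix.det_one] at h1
    exact zero_ne_one h1
  have hpair : ∀ a b c, b ≠ a → R (s b) a ≠ 0 → R (s c) a ≠ 0 → c = a ∨ c = b := by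
    intro a b c hba hb hc
    have := eq_or_eq_of_card_columnSupport_le_two (hsupp a) (hs a) hb
      (fun h => hba (s.injective h).symm) hc
    exact this.imp (fun h => s.injective h) fun h => s.injective h
  have hsymm : ∀ a b, b ≠ a → R (s b) a ≠ 0 → R (s a) b ≠ 0 := by
    intro a b hba hb hab
    have h := star_mul_add_star_mul_eq_zero hR hba.symm (fun h => hba (s.injective h).symm)
      fun k hk => eq_or_eq_of_card_columnSupport_le_two (hsupp a) (hs a) hb
        (fun h => hba (s.injective h).symm) hk
    rw [hab, mul_zero, zero_add] at h
    rcases mul_eq_zero.mp h with h | h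
    exacts [hb (star_eq_zero.mp h), hs b h]
  classical
  let σ : ι → ι := fun a => if h : ∃ b, b ≠ a ∧ R (s b) a ≠ 0 then h.choose else a
  have hσ : ∀ a b, b ≠ a → R (s b) a ≠ 0 → σ a = b := by
    intro a b hba hb
    have h : ∃ b, b ≠ a ∧ R (s b) a ≠ 0 := ⟨b, hba, hb⟩
    have h1 : σ a = h.choose := dif_pos h
    rw [h1]
    exact (hpair a b _ hba hb h.choose_spec.2).resolve_left h.choose_spec.1
  have hinv : Function.Involutive σ := by
    intro a
    by_cases h : ∃ b, b ≠ a ∧ R (s b) a ≠ 0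
    · obtain ⟨b, hba, hb⟩ := h
      rw [hσ a b hba hb]
      exact hσ b a hba.symm (hsymm a b hba hb)
    · have h1 : σ a = a := dif_neg h
      rw [h1, h1]
  obtain ⟨π, hπ, hfree, hext⟩ := exists_fixedPointFree_involution_extending hι σ hinv
  refine ⟨s, π, hπ, hfree, fun a b hb => ?_⟩
  by_cases hba : b = a
  · exact Or.inl hba
  · right
    have h1 := hσ a b hba hb
    rw [hext a (by rwa [h1]), h1]

end SparseUnitary

/-! ### Two qubits -/

/-- Entrywise complex conjugation of gates. -/
noncomputable def conjGate (n : ℕ) : QGate n →* QGate n where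
  toFun U := ⟨U.1.map star, by
    have h := congrArg (fun A => A.map (starRingEnd ℂ)) (Matrix.mem_unitaryGroup_iff.mp U.2)
    have hstar : star (U.1.map star) = (star U.1).map star := by
      ext x y
      simp [Matrix.star_apply]
    rw [Matrix.mem_unitaryGroup_iff, hstar]
    refine (Matrix.map_mul (f := starRingEnd ℂ)).symm.trans (h.trans ?_)
    exact Matrix.map_one _ (map_zero _) (map_one _)⟩
  map_one' := Subtype.ext (Matrix.map_one _ (star_zero ℂ) (star_one ℂ))
  map_mul' U V := by
    apply Subtype.ext
    exact Matrix.map_mul (f := starRingEnd ℂ)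

theorem coe_conjGate_inv {n : ℕ} (U : QGate n) : ((conjGate n U)⁻¹).1 = U.1.transpose := by
  ext x y
  simp [conjGate, Matrix.UnitaryGroup.inv_val, Matrix.star_apply]

/-- The labels of the six antisymmetric two-qubit Pauli strings
`Y ⊗ I, X ⊗ Y, Z ⊗ Y, I ⊗ Y, Y ⊗ X, Y ⊗ Z`. -/
def antisymmetricIndex : Fin 6 → Fin 2 → Fin 4 :=
  ![![2, 0], ![1, 2], ![3, 2], ![0, 2], ![2, 1], ![2, 3]]

/-- Phases for the antisymmetric Pauli strings, chosen so that `γ_a γ_b† = -γ_b γ_a†` for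
`a ≠ b`. -/
noncomputable def antisymmetricCoeff : Fin 6 → ℂ :=
  ![1, 1, 1, Complex.I, Complex.I, Complex.I]

theorem antisymmetricIndex_transpose (a : Fin 6) :
    (pauliString (antisymmetricIndex a)).transpose = -pauliString (antisymmetricIndex a) := by
  have h : ∀ a : Fin 6, (∏ i, if antisymmetricIndex a i = 2 then -1 else 1 : ℤ) = -1 := by decide
  rw [pauliString_transpose, h]
  simp

theorem transpose_of_notMem_antisymmetricIndex {s : Fin 2 → Fin 4}
    (hs : s ∉ Set.range antisymmetricIndex) : (pauliString s).transpose = pauliString s := by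
  have h : ∀ x y : Fin 4, (∀ a, antisymmetricIndex a ≠ ![x, y]) →
      (∏ i, if (![x, y] : Fin 2 → Fin 4) i = 2 then -1 else 1 : ℤ) = 1 := by decide
  have hxy : s = ![s 0, s 1] := by
    ext i
    fin_cases i <;> rfl
  have h1 : (∏ i, if s i = 2 then -1 else 1 : ℤ) = 1 := by
    rw [hxy]
    exact h _ _ fun a ha => hs ⟨a, by rw [ha, ← hxy]⟩
  rw [pauliString_transpose, h1]
  simp

/-- The frame of the antisymmetric two-qubit Pauli strings, on which `U` acts by `A ↦ U A Uᵀ`. The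
resulting six-dimensional representation is the exterior square of the standard one; restricted to
determinant one it realizes the covering `SU(4) → SO(6)`. -/
noncomputable def antisymmetricFrame : PauliFrame 2 (Fin 6) where
  index := antisymmetricIndex
  coeff := antisymmetricCoeff
  twist := conjGate 2
  index_injective := by decide
  coeff_pow_four a := by
    fin_cases a <;> simp [antisymmetricCoeff]
  trace_eq_zero U a s hs := by
    rw [coe_conjGate_inv]
    set B := U.1 * (antisymmetricCoeff a • pauliString (antisymmetricIndex a)) * U.1.transpose
      with hB
    have hBt : B.transpose = -B := by
      rw [hB, Matrix.transpose_mul, Matrix.transpose_mul, Matrix.transpose_transpose,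
        Matrix.transpose_smul, antisymmetricIndex_transpose]
      simp [Matrix.mul_assoc]
    have h : (pauliString s * B).trace = -(pauliString s * B).trace := by
      conv_lhs => rw [← Matrix.trace_transpose, Matrix.transpose_mul, hBt,
        transpose_of_notMem_antisymmetricIndex hs, Matrix.neg_mul, Matrix.trace_neg,
        Matrix.trace_mul_comm]
    exact self_eq_neg.mp h

local notation "γ" => antisymmetricFrame.gate

theorem antisymmetricFrame_mul_star_self (a : Fin 6) : (γ a).1 * star (γ a).1 = 1 :=
  Matrix.mem_unitaryGroup_iff.mp (γ a).2

theorem antisymmetricFrame_star_mul_self (a : Fin 6) : star (γ a).1 * (γ a).1 = 1 :=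
  Matrix.mem_unitaryGroup_iff'.mp (γ a).2

theorem antisymmetricFrame_mul_star {a b : Fin 6} (hab : a ≠ b) :
    (γ a).1 * star (γ b).1 = -((γ b).1 * star (γ a).1) := by
  have hsign : ∀ a b : Fin 6, ∏ i, pauliSign (antisymmetricIndex a i) (antisymmetricIndex b i) =
      if a ≠ b ∧ (a < 3 ↔ b < 3) then -1 else 1 := by decide
  have hcoeff : ∀ a, antisymmetricCoeff a = if a < 3 then 1 else Complex.I := by
    intro a
    fin_cases a <;> rfl
  rw [PauliFrame.star_gate, PauliFrame.star_gate, PauliFrame.coe_gate, PauliFrame.coe_gate]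
  change antisymmetricCoeff a • pauliString (antisymmetricIndex a) *
      star (antisymmetricCoeff b) • pauliString (antisymmetricIndex b) =
    -(antisymmetricCoeff b • pauliString (antisymmetricIndex b) *
      star (antisymmetricCoeff a) • pauliString (antisymmetricIndex a))
  simp only [Matrix.smul_mul, Matrix.mul_smul, smul_smul]
  rw [pauliString_mul_comm, hsign, smul_smul, ← neg_smul]
  congr 1
  rw [hcoeff, hcoeff]
  by_cases h1 : a < 3 <;> by_cases h2 : b < 3 <;> simp [hab, h1, h2]

theorem antisymmetricFrame_star_transpose (a : Fin 6) :
    (star (γ a).1).transpose = -star (γ a).1 := by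
  rw [PauliFrame.star_gate, Matrix.transpose_smul]
  change _ • (pauliString (antisymmetricIndex a)).transpose =
    -(_ • pauliString (antisymmetricIndex a))
  rw [antisymmetricIndex_transpose, smul_neg]

theorem antisymmetricFrame_transpose (a : Fin 6) : (γ a).1.transpose = -(γ a).1 := by
  rw [PauliFrame.coe_gate, Matrix.transpose_smul]
  change _ • (pauliString (antisymmetricIndex a)).transpose =
    -(_ • pauliString (antisymmetricIndex a))
  rw [antisymmetricIndex_transpose, smul_neg]

theorem antisymmetricFrame_star_mul {a b : Fin 6} (hab : a ≠ b) :
    star (γ a).1 * (γ b).1 = -(star (γ b).1 * (γ a).1) := by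
  have h := congrArg Matrix.transpose (antisymmetricFrame_mul_star hab.symm)
  simp only [Matrix.transpose_mul, Matrix.transpose_neg, antisymmetricFrame_star_transpose,
    antisymmetricFrame_transpose, neg_mul_neg] at h
  exact h

/-- The Pauli gate `γ_a γ_b†`, which for `a ≠ b` acts on the frame by changing the signs of `γ_a`
and `γ_b`. -/
noncomputable def pairGate (a b : Fin 6) : QGate 2 :=
  γ a * (γ b)⁻¹

theorem coe_pairGate (a b : Fin 6) : (pairGate a b).1 = (γ a).1 * star (γ b).1 := by
  rw [pairGate, Submonoid.coe_mul, Matrix.UnitaryGroup.inv_val]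

theorem pairGate_mem (a b : Fin 6) : pairGate a b ∈ pauliGroup 2 :=
  mul_mem (antisymmetricFrame.gate_mem a) (inv_mem (antisymmetricFrame.gate_mem b))

theorem pairGate_self (a : Fin 6) : pairGate a a = 1 :=
  mul_inv_cancel _

/-- The sign by which `γ_a γ_b†` acts on `γ_c`. -/
def pairSign (a b c : Fin 6) : ℤ :=
  if c = a ∨ c = b then -1 else 1

theorem pairGate_conj_gate {a b : Fin 6} (hab : a ≠ b) (c : Fin 6) :
    (pairGate a b * γ c * (antisymmetricFrame.twist (pairGate a b))⁻¹).1 =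
      (pairSign a b c : ℂ) • (γ c).1 := by
  have htwist : ((antisymmetricFrame.twist (pairGate a b))⁻¹).1 = star (γ b).1 * (γ a).1 := by
    change ((conjGate 2 (pairGate a b))⁻¹).1 = _
    rw [coe_conjGate_inv, coe_pairGate, Matrix.transpose_mul, antisymmetricFrame_star_transpose,
      antisymmetricFrame_transpose, neg_mul_neg]
  rw [Submonoid.coe_mul, Submonoid.coe_mul, htwist, coe_pairGate, pairSign]
  have hmul := antisymmetricFrame_mul_star_self
  have hmul' := antisymmetricFrame_star_mul_self
  by_cases hca : c = a
  · subst hca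
    have hsq : star (γ b).1 * (γ c).1 * (star (γ b).1 * (γ c).1) = -1 := by
      calc star (γ b).1 * (γ c).1 * (star (γ b).1 * (γ c).1)
          = -(star (γ c).1 * (γ b).1) * (star (γ b).1 * (γ c).1) :=
            congrArg (· * (star (γ b).1 * (γ c).1)) (antisymmetricFrame_star_mul hab.symm)
        _ = -(star (γ c).1 * ((γ b).1 * star (γ b).1) * (γ c).1) := by
            simp only [Matrix.mul_assoc, Matrix.neg_mul]
        _ = -1 := by rw [hmul, Matrix.mul_one, hmul']
    rw [Matrix.mul_assoc (γ c).1, Matrix.mul_assoc (γ c).1, hsq]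
    simp
  · by_cases hcb : c = b
    · subst hcb
      calc (γ a).1 * star (γ c).1 * (γ c).1 * (star (γ c).1 * (γ a).1)
          = (γ a).1 * (star (γ c).1 * (γ c).1) * (star (γ c).1 * (γ a).1) := by
            simp only [Matrix.mul_assoc]
        _ = (γ a).1 * star (γ c).1 * (γ a).1 := by rw [hmul', Matrix.mul_one, Matrix.mul_assoc]
        _ = -((γ c).1 * (star (γ a).1 * (γ a).1)) := by
            rw [antisymmetricFrame_mul_star hab, Matrix.neg_mul, Matrix.mul_assoc]
        _ = _ := by simp [hmul']
    · calc (γ a).1 * star (γ b).1 * (γ c).1 * (star (γ b).1 * (γ a).1)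
          = (γ a).1 * (star (γ b).1 * (γ c).1) * (star (γ b).1 * (γ a).1) := by
            simp only [Matrix.mul_assoc]
        _ = -((γ a).1 * star (γ c).1 * ((γ b).1 * star (γ b).1) * (γ a).1) := by
            rw [antisymmetricFrame_star_mul (Ne.symm hcb)]
            simp only [Matrix.mul_assoc, Matrix.neg_mul, Matrix.mul_neg]
        _ = (γ c).1 * (star (γ a).1 * (γ a).1) := by
            rw [hmul, Matrix.mul_one, antisymmetricFrame_mul_star (Ne.symm hca)]
            simp [Matrix.mul_assoc]
        _ = _ := by simp [hmul', hca, hcb]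

theorem rep_pairGate {a b : Fin 6} (hab : a ≠ b) :
    antisymmetricFrame.rep (pairGate a b) = Matrix.diagonal fun c => (pairSign a b c : ℂ) :=
  antisymmetricFrame.rep_eq_diagonal (pairGate_conj_gate hab)

/-- Pauli gates act on each antisymmetric Pauli string by a scalar. -/
theorem exists_rep_eq_diagonal {P : QGate 2} (hP : P ∈ pauliGroup 2) :
    ∃ d, antisymmetricFrame.rep P = Matrix.diagonal d := by
  obtain ⟨c, s, hc, h⟩ := mem_pauliGroup_iff.mp hP
  have key : ∀ a, ∃ d : ℂ, (P * γ a * (antisymmetricFrame.twist P)⁻¹).1 = d • (γ a).1 := by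
    intro a
    have htwist : ((antisymmetricFrame.twist P)⁻¹).1 = P.1.transpose := coe_conjGate_inv P
    obtain ⟨e, he⟩ : ∃ e : ℂ, (pauliString s).transpose = e • pauliString s :=
      ⟨_, pauliString_transpose s⟩
    obtain ⟨f, hf⟩ : ∃ f : ℂ, pauliString s * pauliString (antisymmetricFrame.index a) =
        f • (pauliString (antisymmetricFrame.index a) * pauliString s) :=
      ⟨_, pauliString_mul_comm s _⟩
    refine ⟨c * f * c * e, ?_⟩
    rw [Submonoid.coe_mul, Submonoid.coe_mul, htwist, h, Matrix.transpose_smul, he,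
      PauliFrame.coe_gate]
    simp only [Matrix.smul_mul, Matrix.mul_smul]
    rw [hf, Matrix.smul_mul, Matrix.mul_assoc, pauliString_mul_self, Matrix.mul_one]
    simp only [smul_smul]
    congr 1
    ring
  choose d hd using key
  exact ⟨d, antisymmetricFrame.rep_eq_diagonal hd⟩

theorem exists_eq_smul_pairGate {P : QGate 2} (hP : P ∈ pauliGroup 2) :
    ∃ (c : ℂ) (a b : Fin 6), P.1 = c • (pairGate a b).1 := by
  obtain ⟨c, s, hc, h⟩ := mem_pauliGroup_iff.mp hP
  have hex : ∀ x y : Fin 4, ∃ a b : Fin 6,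
      antisymmetricIndex a 0 ^^^ antisymmetricIndex b 0 = x ∧
        antisymmetricIndex a 1 ^^^ antisymmetricIndex b 1 = y := by decide
  obtain ⟨a, b, h0, h1⟩ := hex (s 0) (s 1)
  have hs : s = fun i => antisymmetricIndex a i ^^^ antisymmetricIndex b i := by
    ext i
    fin_cases i
    · simp [h0]
    · simp [h1]
  obtain ⟨d, hd, hmul⟩ :=
    exists_pauliString_mul_eq_xor (antisymmetricIndex a) (antisymmetricIndex b)
  rw [← hs] at hmul
  have hcoeff : antisymmetricFrame.coeff a * star (antisymmetricFrame.coeff b) ≠ 0 := by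
    have := antisymmetricFrame.star_coeff_mul_coeff
    refine mul_ne_zero ?_ ?_
    · exact right_ne_zero_of_mul_eq_one (this a)
    · exact left_ne_zero_of_mul_eq_one (this b)
  refine ⟨c * (antisymmetricFrame.coeff a * star (antisymmetricFrame.coeff b) * d)⁻¹, a, b, ?_⟩
  rw [coe_pairGate, PauliFrame.star_gate, PauliFrame.coe_gate, Matrix.smul_mul, Matrix.mul_smul,
    smul_smul]
  change _ = _ • _ • (pauliString (antisymmetricIndex a) * pauliString (antisymmetricIndex b))
  rw [hmul, smul_smul, smul_smul, h]
  congr 1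
  have ha := left_ne_zero_of_mul hcoeff
  have hb := right_ne_zero_of_mul hcoeff
  field_simp

/-- Every two-qubit gate of the hierarchy is represented by a matrix with at most two nonzero
entries in each column. -/
theorem card_columnSupport_rep_le_two (k : ℕ) {U : QGate 2} (hU : U ∈ gateHierarchy 2 (k + 1))
    (a : Fin 6) : (columnSupport (antisymmetricFrame.rep U) a).card ≤ 2 := by
  induction k generalizing U a with
  | zero =>
    obtain ⟨d, hd⟩ := exists_rep_eq_diagonal (mem_gateHierarchy_one.mp hU)
    have hsub : columnSupport (antisymmetricFrame.rep U) a ⊆ {a} := by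
      intro i hi
      rw [mem_columnSupport, hd] at hi
      by_contra hne
      exact hi (Matrix.diagonal_apply_ne _ (by simpa using hne))
    have := Finset.card_le_card hsub
    rw [Finset.card_singleton] at this
    omega
  | succ k ih =>
    set R := antisymmetricFrame.rep U with hRdef
    have hR : R ∈ Matrix.unitaryGroup (Fin 6) ℂ := antisymmetricFrame.rep_mem_unitaryGroup U
    -- `M` represents the conjugate `U P U⁻¹` of a Pauli gate; it is `1 - 2 Π` for the projection `Π`
    -- onto the span of the columns `a` and `b` of `R`, and sparse by the induction hypothesis
    have key : ∀ a b : Fin 6, a ≠ b →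
        (columnSupport R a ∪ columnSupport R b).card +
          (Finset.univ.filter fun i => ‖R i a‖ ^ 2 + ‖R i b‖ ^ 2 = 1).card = 4 := by
      intro a b hab
      have hV := mem_gateHierarchy_add_two.mp hU _ (pairGate_mem a b)
      set M := antisymmetricFrame.rep (U * pairGate a b * U⁻¹) with hMdef
      have hM : M = R * Matrix.diagonal (fun c => (pairSign a b c : ℂ)) * star R := by
        rw [hMdef, PauliFrame.rep_mul, PauliFrame.rep_mul, PauliFrame.rep_inv, rep_pairGate hab]
      have hstar : star M = M := by
        rw [hM, star_mul, star_mul, star_star, Matrix.star_eq_conjTranspose (Matrix.diagonal _),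
          Matrix.diagonal_conjTranspose, Matrix.mul_assoc]
        congr 3
        ext c
        simp
      have htrace : M.trace = 2 := by
        have h2 : ∀ a b : Fin 6, a ≠ b → ∑ c, pairSign a b c = 2 := by decide
        rw [hM, Matrix.trace_mul_comm, ← Matrix.mul_assoc, Matrix.mem_unitaryGroup_iff'.mp hR,
          Matrix.one_mul, Matrix.trace_diagonal, ← Int.cast_sum, h2 a b hab]
        norm_num
      have hdiag : ∀ i, M i i = ((1 - 2 * (‖R i a‖ ^ 2 + ‖R i b‖ ^ 2) : ℝ) : ℂ) := by
        intro i
        have h1 : M i i = ((∑ c, (pairSign a b c : ℝ) * ‖R i c‖ ^ 2 : ℝ) : ℂ) := by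
          rw [hM, Matrix.mul_apply, Complex.ofReal_sum]
          refine Finset.sum_congr rfl fun c _ => ?_
          rw [Matrix.mul_diagonal, Matrix.star_apply, Complex.star_def, mul_right_comm,
            Complex.mul_conj, Complex.normSq_eq_norm_sq]
          push_cast
          ring
        have h2 : ∀ c, (pairSign a b c : ℝ) * ‖R i c‖ ^ 2 = ‖R i c‖ ^ 2 -
            2 * (if c = a then ‖R i c‖ ^ 2 else 0) - 2 * (if c = b then ‖R i c‖ ^ 2 else 0) := by
          intro c
          by_cases hca : c = a
          · subst hca
            simp [pairSign, hab]
            ring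
          · by_cases hcb : c = b
            · subst hcb
              simp [pairSign, hca]
              ring
            · simp [pairSign, hca, hcb]
        rw [h1]
        simp only [h2]
        rw [Finset.sum_sub_distrib, Finset.sum_sub_distrib, sum_norm_sq_row hR, ← Finset.mul_sum,
          ← Finset.mul_sum]
        simp
        ring
      have hcount := trace_eq_card_sub_card (antisymmetricFrame.rep_mem_unitaryGroup _) hstar
        (fun c => ih hV c)
      have hone : (Finset.univ.filter fun i => M i i = 1) =
          (columnSupport R a ∪ columnSupport R b)ᶜ := by
        ext i
        simp only [Finset.mem_filter, Finset.mem_univ, true_and, Finset.mem_compl,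
          Finset.mem_union, mem_columnSupport, not_or, not_not, hdiag]
        constructor
        · intro h
          have h' : 1 - 2 * (‖R i a‖ ^ 2 + ‖R i b‖ ^ 2) = 1 := by exact_mod_cast h
          have ha := sq_nonneg ‖R i a‖
          have hb := sq_nonneg ‖R i b‖
          constructor
          · have : ‖R i a‖ ^ 2 = 0 := by linarith
            simpa using this
          · have : ‖R i b‖ ^ 2 = 0 := by linarith
            simpa using this
        · rintro ⟨h1, h2⟩
          simp [h1, h2]
      have hneg : (Finset.univ.filter fun i => M i i = -1) =
          Finset.univ.filter fun i => ‖R i a‖ ^ 2 + ‖R i b‖ ^ 2 = 1 := by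
        ext i
        simp only [Finset.mem_filter, Finset.mem_univ, true_and, hdiag]
        constructor
        · intro h
          have h' : 1 - 2 * (‖R i a‖ ^ 2 + ‖R i b‖ ^ 2) = -1 := by exact_mod_cast h
          linarith
        · intro h
          rw [h]
          norm_num
      rw [htrace, hone, hneg, Finset.card_compl, Fintype.card_fin] at hcount
      have hle : (columnSupport R a ∪ columnSupport R b).card ≤ 6 := by
        simpa using Finset.card_le_univ (columnSupport R a ∪ columnSupport R b)
      have hcount' : (2 : ℤ) = (6 - (columnSupport R a ∪ columnSupport R b).card : ℕ) -
          ((Finset.univ.filter fun i => ‖R i a‖ ^ 2 + ‖R i b‖ ^ 2 = 1).card : ℤ) := by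
        exact_mod_cast hcount
      omega
    refine card_columnSupport_le_two hR (by simp) (fun a b hab => ?_) (fun a b i hab hi => ?_) a
    · have := key a b hab
      omega
    · have := key a b hab
      have hpos : 0 < (Finset.univ.filter fun i => ‖R i a‖ ^ 2 + ‖R i b‖ ^ 2 = 1).card :=
        Finset.card_pos.mpr ⟨i, by simpa using hi⟩
      omega

theorem pairGate_conj_pairGate {a b : Fin 6} (hab : a ≠ b) (c d : Fin 6) :
    (pairGate a b * pairGate c d * (pairGate a b)⁻¹).1 =
      ((pairSign a b c * pairSign a b d : ℤ) : ℂ) • (pairGate c d).1 := by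
  have h : pairGate a b * pairGate c d * (pairGate a b)⁻¹ =
      (pairGate a b * γ c * (antisymmetricFrame.twist (pairGate a b))⁻¹) *
        (pairGate a b * γ d * (antisymmetricFrame.twist (pairGate a b))⁻¹)⁻¹ := by
    rw [pairGate, pairGate]
    group
  rw [h, Submonoid.coe_mul, Matrix.UnitaryGroup.inv_val, pairGate_conj_gate hab,
    pairGate_conj_gate hab, star_smul, Matrix.smul_mul, Matrix.mul_smul, smul_smul, coe_pairGate]
  simp

/-- The Pauli gates attached to the cells of the pairing `π` of the frame. -/
def pairingSet (π : Fin 6 → Fin 6) : Set (QGate 2) :=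
  {P | ∃ a b, (b = a ∨ b = π a) ∧ P = pairGate a b}

theorem isSelfCentralizing_pairingSet {π : Fin 6 → Fin 6} (hπ : Function.Involutive π)
    (hfree : ∀ a, π a ≠ a) : IsSelfCentralizing (pairingSet π) where
  mem_pauliGroup := by
    rintro _ ⟨a, b, -, rfl⟩
    exact pairGate_mem a b
  comm := by
    rintro _ ⟨a, b, hab, rfl⟩ _ ⟨c, d, hcd, rfl⟩
    rcases hab with rfl | rfl
    · simp [pairGate_self]
    · have hsign : pairSign a (π a) c * pairSign a (π a) d = 1 := by
        have hcases : pairSign a (π a) d = pairSign a (π a) c := by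
          rcases hcd with rfl | rfl
          · rfl
          · have h1 : π c = a ↔ c = π a := ⟨fun h => by rw [← h, hπ c], fun h => by rw [h, hπ a]⟩
            have h2 : π c = π a ↔ c = a := hπ.injective.eq_iff
            simp only [pairSign, h1, h2, or_comm]
        rw [hcases, pairSign]
        split_ifs <;> norm_num
      have h := pairGate_conj_pairGate (hfree a).symm c d
      rw [hsign, Int.cast_one, one_smul] at h
      exact mul_inv_eq_iff_eq_mul.mp (Subtype.ext h)
  exists_eq_smul := by
    intro p hp hcomm
    obtain ⟨c, a, b, h⟩ := exists_eq_smul_pairGate hp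
    by_cases hab : b = a ∨ b = π a
    · exact ⟨c, _, ⟨a, b, hab, rfl⟩, h⟩
    · exfalso
      rw [not_or] at hab
      have hc : c ≠ 0 := by
        rintro rfl
        exact qGate_coe_ne_zero p (by rw [h, zero_smul])
      have h1 := mul_comm_of_eq_smul (p := pairGate a b) (c := c⁻¹)
        (by rw [h, smul_smul, inv_mul_cancel₀ hc, one_smul])
        (hcomm (pairGate a (π a)) ⟨a, π a, Or.inr rfl, rfl⟩)
      have h2 := pairGate_conj_pairGate (Ne.symm hab.1) a (π a)
      have hsign : pairSign a b a * pairSign a b (π a) = -1 := by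
        simp [pairSign, hfree a, Ne.symm hab.2]
      rw [← h1, mul_inv_cancel_right, hsign, Int.cast_neg, Int.cast_one, neg_one_smul] at h2
      exact qGate_coe_ne_zero _ (Matrix.ext fun x y => self_eq_neg.mp (congrFun (congrFun h2 x) y))

/-- If `u` and `v` are orthogonal combinations of `A` and `B`, then `u v†` is a multiple of `A B†`. -/
theorem plane_mul_star {m : Type} [Fintype m] [DecidableEq m] {A B : Matrix m m ℂ} {x y z w : ℂ}
    (hA : A * star A = 1) (hB : B * star B = 1) (hBA : B * star A = -(A * star B))
    (h : star x * z + star y * w = 0) :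
    (x • A + y • B) * star (z • A + w • B) = (x * star w - y * star z) • (A * star B) := by
  have h' : y * star w = -(x * star z) := by
    have := congrArg star h
    simp only [star_add, star_mul', star_star, star_zero] at this
    linear_combination this
  simp only [star_add, star_smul, Matrix.add_mul, Matrix.mul_add, Matrix.smul_mul, Matrix.mul_smul,
    hA, hB, hBA]
  linear_combination (norm := module) h' • (1 : Matrix m m ℂ)

theorem exists_conj_pairGate_eq_smul {U : QGate 2} {s : Equiv.Perm (Fin 6)} {π : Fin 6 → Fin 6}
    (hπ : Function.Involutive π) (hfree : ∀ a, π a ≠ a)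
    (h : ∀ a b, antisymmetricFrame.rep U (s b) a ≠ 0 → b = a ∨ b = π a) (a : Fin 6) :
    ∃ c : ℂ, (U * pairGate a (π a) * U⁻¹).1 = c • (pairGate (s a) (s (π a))).1 := by
  set R := antisymmetricFrame.rep U with hRdef
  have hR : R ∈ Matrix.unitaryGroup (Fin 6) ℂ := antisymmetricFrame.rep_mem_unitaryGroup U
  have hne : s a ≠ s (π a) := fun h => hfree a (s.injective h).symm
  have hsupp : ∀ k, R k a ≠ 0 → k = s a ∨ k = s (π a) := fun k hk => by
    have := h a (s.symm k) (by rwa [Equiv.apply_symm_apply])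
    simpa [Equiv.symm_apply_eq] using this
  have hsupp' : ∀ k, R k (π a) ≠ 0 → k = s a ∨ k = s (π a) := fun k hk => by
    have := h (π a) (s.symm k) (by rwa [Equiv.apply_symm_apply])
    rw [hπ a] at this
    simpa [Equiv.symm_apply_eq, or_comm] using this
  have hexp : ∀ b, (∀ k, R k b ≠ 0 → k = s a ∨ k = s (π a)) →
      (U * γ b * (antisymmetricFrame.twist U)⁻¹).1 =
        R (s a) b • (γ (s a)).1 + R (s (π a)) b • (γ (s (π a))).1 := by
    intro b hb
    rw [PauliFrame.conj_gate, ← Finset.sum_pair (f := fun k => R k b • (γ k).1) hne]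
    symm
    refine Finset.sum_subset (Finset.subset_univ _) fun k _ hk => ?_
    have : R k b = 0 := by
      by_contra hne
      exact hk (by simpa using hb k hne)
    rw [this, zero_smul]
  have hprod : U * pairGate a (π a) * U⁻¹ =
      (U * γ a * (antisymmetricFrame.twist U)⁻¹) *
        (U * γ (π a) * (antisymmetricFrame.twist U)⁻¹)⁻¹ := by
    rw [pairGate]
    group
  refine ⟨R (s a) a * star (R (s (π a)) (π a)) - R (s (π a)) a * star (R (s a) (π a)), ?_⟩
  rw [hprod, Submonoid.coe_mul, Matrix.UnitaryGroup.inv_val, hexp a hsupp, hexp (π a) hsupp',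
    coe_pairGate]
  exact plane_mul_star (antisymmetricFrame_mul_star_self _) (antisymmetricFrame_mul_star_self _)
    (antisymmetricFrame_mul_star hne.symm)
    (star_mul_add_star_mul_eq_zero hR (hfree a).symm hne hsupp)

/-- Every two-qubit gate of the hierarchy is semi-Clifford. -/
theorem isSemiClifford_of_mem_gateHierarchy_two_qubits (k : ℕ) {U : QGate 2}
    (hU : U ∈ gateHierarchy 2 (k + 1)) : IsSemiClifford U := by
  obtain ⟨s, π, hπ, hfree, h⟩ := exists_perm_involution
    (antisymmetricFrame.rep_mem_unitaryGroup U) (by simp; decide)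
    (card_columnSupport_rep_le_two k hU)
  set π' : Fin 6 → Fin 6 := fun c => s (π (s.symm c)) with hπ'def
  have hπ' : Function.Involutive π' := fun c => by simp [hπ'def, hπ _]
  have hfree' : ∀ c, π' c ≠ c := fun c hc => hfree (s.symm c) (by
    rw [Equiv.eq_symm_apply]
    exact hc)
  have h' : ∀ c d, antisymmetricFrame.rep U⁻¹ (s.symm d) c ≠ 0 → d = c ∨ d = π' c := by
    intro c d hcd
    rw [PauliFrame.rep_inv, Matrix.star_apply] at hcd
    rcases h (s.symm d) (s.symm c) (by simpa using hcd) with h1 | h1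
    · exact Or.inl (s.symm.injective h1).symm
    · right
      rw [hπ'def]
      simp only
      rw [h1, hπ, Equiv.apply_symm_apply]
  refine (isSelfCentralizing_pairingSet hπ hfree).isSemiClifford
    (isSelfCentralizing_pairingSet hπ' hfree') ?_ ?_
  · rintro _ ⟨a, b, hab, rfl⟩
    rcases hab with hab | rfl
    · rw [hab]
      exact ⟨1, _, ⟨a, a, Or.inl rfl, rfl⟩, by simp [pairGate_self]⟩
    · obtain ⟨c, hc⟩ := exists_conj_pairGate_eq_smul hπ hfree h a
      exact ⟨c, _, ⟨s a, s (π a), Or.inr (by simp [hπ'def]), rfl⟩, hc⟩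
  · rintro _ ⟨a, b, hab, rfl⟩
    rcases hab with hab | rfl
    · rw [hab]
      exact ⟨1, _, ⟨a, a, Or.inl rfl, rfl⟩, by simp [pairGate_self]⟩
    · obtain ⟨c, hc⟩ := exists_conj_pairGate_eq_smul (U := U⁻¹) (s := s.symm) hπ' hfree' h' a
      rw [inv_inv] at hc
      exact ⟨c, _, ⟨s.symm a, s.symm (π' a), Or.inr (by simp [hπ'def]), rfl⟩, hc⟩

/-! ### One qubit -/

/-- The labels of the three nontrivial one-qubit Pauli matrices. -/
def singleQubitIndex (a : Fin 3) : Fin 1 → Fin 4 :=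
  fun _ => a.succ

/-- The frame `X, Y, Z` of the traceless one-qubit operators, on which gates act by conjugation; this
is the covering `SU(2) → SO(3)`. -/
noncomputable def singleQubitFrame : PauliFrame 1 (Fin 3) where
  index := singleQubitIndex
  coeff _ := 1
  twist := MonoidHom.id _
  index_injective a b h := Fin.succ_injective 3 (congrFun h 0)
  coeff_pow_four a := one_pow 4
  trace_eq_zero U a s hs := by
    have hs0 : s = 0 := by
      ext i
      rw [Subsingleton.elim i 0]
      by_contra hne
      obtain ⟨a, ha⟩ := Fin.exists_succ_eq.mpr (fun h => hne (by rw [h]; rfl) : s 0 ≠ 0)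
      exact hs ⟨a, funext fun j => by rw [Subsingleton.elim j 0, ← ha]; rfl⟩
    have htr := pauliString_trace_mul (0 : Fin 1 → Fin 4) (singleQubitIndex a)
    rw [if_neg fun h => Fin.succ_ne_zero a (congrFun h 0).symm, pauliString_zero,
      Matrix.one_mul] at htr
    rw [hs0, pauliString_zero, Matrix.one_mul, MonoidHom.id_apply, Matrix.mul_assoc,
      Matrix.trace_mul_comm, Matrix.mul_assoc, Matrix.UnitaryGroup.inv_val,
      Matrix.mem_unitaryGroup_iff'.mp U.2, Matrix.mul_one, one_smul, htr]

local notation "σ" => singleQubitFrame.gate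

theorem coe_singleQubitFrame_gate (a : Fin 3) : (σ a).1 = pauliString (singleQubitIndex a) :=
  one_smul _ _

theorem pauli_conj_singleQubitFrame {P : QGate 1} {c : ℂ} {s : Fin 1 → Fin 4}
    (h : P.1 = c • pauliString s) (a : Fin 3) :
    (P * σ a * P⁻¹).1 = (pauliSign (s 0) a.succ : ℂ) • (σ a).1 := by
  have h1 : P.1 * (σ a).1 = (pauliSign (s 0) a.succ : ℂ) • ((σ a).1 * P.1) := by
    rw [h, coe_singleQubitFrame_gate, Matrix.smul_mul, pauliString_mul_comm, Matrix.mul_smul,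
      smul_comm]
    simp [singleQubitIndex]
  rw [Submonoid.coe_mul, Submonoid.coe_mul, h1, Matrix.smul_mul, Matrix.mul_assoc,
    Matrix.UnitaryGroup.inv_val, Matrix.mem_unitaryGroup_iff.mp P.2, Matrix.mul_one]

theorem rep_singleQubitFrame_pauli {P : QGate 1} {c : ℂ} {s : Fin 1 → Fin 4}
    (h : P.1 = c • pauliString s) :
    singleQubitFrame.rep P = Matrix.diagonal fun a => (pauliSign (s 0) a.succ : ℂ) :=
  singleQubitFrame.rep_eq_diagonal (pauli_conj_singleQubitFrame h)

/-- If every column of a unitary matrix of size three has a zero, then some column has two. -/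
theorem exists_column_eq_single {R : Matrix (Fin 3) (Fin 3) ℂ}
    (hR : R ∈ Matrix.unitaryGroup (Fin 3) ℂ) (hzero : ∀ a, ∃ i, R i a = 0) :
    ∃ a b, ∀ i, i ≠ b → R i a = 0 := by
  choose f hf using hzero
  by_cases hinj : Function.Injective f
  · have hsurj := Finite.injective_iff_surjective.mp hinj
    have hcover : ∀ k, k = f 0 ∨ k = f 1 ∨ k = f 2 := by
      intro k
      obtain ⟨m, rfl⟩ := hsurj k
      fin_cases m <;> simp
    have horth := sum_star_mul_of_mem_unitaryGroup hR 0 1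
    rw [if_neg (by decide), Finset.sum_eq_single (f 2)] at horth
    · rcases mul_eq_zero.mp horth with h | h
      · refine ⟨0, f 1, fun i hi => ?_⟩
        rcases hcover i with rfl | rfl | rfl
        exacts [hf 0, absurd rfl hi, star_eq_zero.mp h]
      · refine ⟨1, f 0, fun i hi => ?_⟩
        rcases hcover i with rfl | rfl | rfl
        exacts [absurd rfl hi, hf 1, h]
    · intro k _ hk
      rcases hcover k with rfl | rfl | rfl
      · simp [hf 0]
      · simp [hf 1]
      · exact absurd rfl hk
    · simp
  · -- a row with two zeros has an entry of modulus one, which is alone in its column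
    obtain ⟨a, b, hab, hne⟩ := Function.not_injective_iff.mp hinj
    have hthird : ∀ a b : Fin 3, a ≠ b → ∃ c, ∀ d, d ≠ a → d ≠ b → d = c := by decide
    obtain ⟨c, hc⟩ := hthird a b hne
    have hrow := sum_norm_sq_row hR (f a)
    have hstar : star R ∈ Matrix.unitaryGroup (Fin 3) ℂ := Unitary.star_mem hR
    have hcol := sum_norm_sq_row hstar c
    rw [Finset.sum_eq_single c] at hrow
    · refine ⟨c, f a, fun i hi => ?_⟩
      have hle : ‖star R c i‖ ^ 2 + ‖star R c (f a)‖ ^ 2 ≤ 1 := by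
        rw [← hcol, ← Finset.sum_pair (f := fun x => ‖star R c x‖ ^ 2) hi]
        exact Finset.sum_le_sum_of_subset_of_nonneg (Finset.subset_univ _)
          fun _ _ _ => by positivity
      rw [Matrix.star_apply, Matrix.star_apply, norm_star, norm_star, hrow] at hle
      have hsq := sq_nonneg ‖R i c‖
      have : ‖R i c‖ ^ 2 = 0 := by linarith
      simpa using this
    · intro d _ hd
      by_cases hda : d = a
      · simp [hda, hf a]
      · by_cases hdb : d = b
        · simp [hdb, hab, hf b]
        · exact absurd (hc d hda hdb) hd
    · simp

/-- Every one-qubit gate of the hierarchy sends one of `X`, `Y`, `Z` to a multiple of one of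
them. -/
theorem exists_rep_column_eq_single (k : ℕ) {U : QGate 1} (hU : U ∈ gateHierarchy 1 (k + 1)) :
    ∃ a b, ∀ i, i ≠ b → singleQubitFrame.rep U i a = 0 := by
  induction k generalizing U with
  | zero =>
    obtain ⟨c, s, hc, h⟩ := mem_pauliGroup_iff.mp (mem_gateHierarchy_one.mp hU)
    refine ⟨0, 0, fun i hi => ?_⟩
    rw [rep_singleQubitFrame_pauli h, Matrix.diagonal_apply_ne _ hi]
  | succ k ih =>
    have hR := singleQubitFrame.rep_mem_unitaryGroup U
    refine exists_column_eq_single hR fun a => ?_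
    have hV := mem_gateHierarchy_add_two.mp hU _ (singleQubitFrame.gate_mem a)
    obtain ⟨j, b, hM⟩ := ih hV
    have hthird : ∀ j b : Fin 3, ∃ i, i ≠ j ∧ i ≠ b := by decide
    obtain ⟨i, hij, hib⟩ := hthird j b
    have hσ : (σ a).1 = (1 : ℂ) • pauliString (singleQubitIndex a) := rfl
    have hsign : ∀ a c : Fin 3, pauliSign (singleQubitIndex a 0) c.succ =
        2 * (if c = a then 1 else 0) - 1 := by decide
    have hent : singleQubitFrame.rep (U * σ a * U⁻¹) i j =
        2 * (singleQubitFrame.rep U i a * star (singleQubitFrame.rep U j a)) := by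
      have horth := congrFun (congrFun (Matrix.mem_unitaryGroup_iff.mp hR) i) j
      rw [Matrix.mul_apply, Matrix.one_apply_ne hij] at horth
      rw [PauliFrame.rep_mul, PauliFrame.rep_mul, PauliFrame.rep_inv,
        rep_singleQubitFrame_pauli hσ, Matrix.mul_apply]
      have hterm : ∀ x, (singleQubitFrame.rep U * Matrix.diagonal fun c : Fin 3 =>
          (pauliSign (singleQubitIndex a 0) c.succ : ℂ)) i x * star (singleQubitFrame.rep U) x j =
          2 * (if x = a then singleQubitFrame.rep U i x * star (singleQubitFrame.rep U) x j else 0) -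
            singleQubitFrame.rep U i x * star (singleQubitFrame.rep U) x j := by
        intro x
        rw [Matrix.mul_diagonal, hsign]
        split_ifs <;> push_cast <;> ring
      rw [Finset.sum_congr rfl fun x _ => hterm x, Finset.sum_sub_distrib, ← Finset.mul_sum, horth]
      simp [Matrix.star_apply]
    have hprod := hM i hib
    rw [hent] at hprod
    rcases mul_eq_zero.mp ((mul_eq_zero.mp hprod).resolve_left two_ne_zero) with h | h
    exacts [⟨i, h⟩, ⟨j, star_eq_zero.mp h⟩]

theorem isSelfCentralizing_singleQubit (a : Fin 3) : IsSelfCentralizing {1, σ a} where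
  mem_pauliGroup := by
    rintro _ (rfl | rfl)
    exacts [one_mem _, singleQubitFrame.gate_mem a]
  comm := by
    rintro _ (rfl | rfl) _ (rfl | rfl) <;> simp
  exists_eq_smul := by
    intro p hp hcomm
    obtain ⟨c, s, hc, h⟩ := mem_pauliGroup_iff.mp hp
    have h1 := hcomm (σ a) (by simp)
    have h2 := pauli_conj_singleQubitFrame h a
    rw [← h1, mul_inv_cancel_right] at h2
    have hsign : ∀ (x : Fin 4) (a : Fin 3), pauliSign x a.succ = -1 ∨ x = 0 ∨ x = a.succ := by
      decide
    rcases hsign (s 0) a with h3 | h3 | h3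
    · rw [h3, Int.cast_neg, Int.cast_one, neg_one_smul] at h2
      exact absurd (Matrix.ext fun x y => self_eq_neg.mp (congrFun (congrFun h2 x) y))
        (qGate_coe_ne_zero (σ a))
    · refine ⟨c, 1, by simp, ?_⟩
      have hs : s = 0 := funext fun i => by rw [Subsingleton.elim i 0, h3]; rfl
      rw [h, hs, pauliString_zero]
      rfl
    · refine ⟨c, σ a, by simp, ?_⟩
      have hs : s = singleQubitIndex a := funext fun i => by rw [Subsingleton.elim i 0, h3]; rfl
      rw [h, hs, coe_singleQubitFrame_gate]

theorem exists_conj_singleQubitFrame_eq_smul (k : ℕ) {U : QGate 1}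
    (hU : U ∈ gateHierarchy 1 (k + 1)) :
    ∃ (a b : Fin 3) (c : ℂ), (U * σ a * U⁻¹).1 = c • (σ b).1 := by
  obtain ⟨a, b, h⟩ := exists_rep_column_eq_single k hU
  refine ⟨a, b, singleQubitFrame.rep U b a, ?_⟩
  refine (singleQubitFrame.conj_gate U a).trans
    (Finset.sum_eq_single b (fun i _ hi => ?_) (by simp))
  rw [h i hi, zero_smul]

/-- Every one-qubit gate of the hierarchy is semi-Clifford. -/
theorem isSemiClifford_of_mem_gateHierarchy_one_qubit (k : ℕ) {U : QGate 1}
    (hU : U ∈ gateHierarchy 1 (k + 1)) : IsSemiClifford U := by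
  obtain ⟨a, b, c, h⟩ := exists_conj_singleQubitFrame_eq_smul k hU
  have hc : c ≠ 0 := by
    rintro rfl
    exact qGate_coe_ne_zero _ (h.trans (zero_smul _ _))
  refine (isSelfCentralizing_singleQubit a).isSemiClifford (isSelfCentralizing_singleQubit b) ?_ ?_
  · rintro _ (rfl | rfl)
    · exact ⟨1, 1, by simp, by simp⟩
    · exact ⟨c, σ b, by simp, h⟩
  · rintro _ (rfl | rfl)
    · exact ⟨1, 1, by simp, by simp⟩
    · refine ⟨c⁻¹, σ a, by simp, ?_⟩
      have h1 : (σ b).1 = c⁻¹ • (U * σ a * U⁻¹).1 := by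
        rw [h, smul_smul, inv_mul_cancel₀ hc, one_smul]
      have h2 : U⁻¹ * (U * σ a * U⁻¹) * U = σ a := by group
      have h3 := congrArg Subtype.val h2
      rw [Submonoid.coe_mul, Submonoid.coe_mul] at h3 ⊢
      rw [h1, Matrix.mul_smul, Matrix.smul_mul, h3]

theorem singleQubitFrame_gate_apply (a : Fin 3) (x y : Fin 1 → Fin 2) :
    (σ a).1 x y = pauliMatrix a.succ (x 0) (y 0) := by
  simp [coe_singleQubitFrame_gate, pauliString, tensorMatrix, singleQubitIndex]

/-- A one-qubit Pauli gate is a scalar or a multiple of `X`, `Y` or `Z`. -/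
theorem eq_smul_one_or_eq_smul_gate {P : QGate 1} (hP : P ∈ pauliGroup 1) :
    ∃ c : ℂ, c ^ 4 = 1 ∧ (P.1 = c • 1 ∨ ∃ a, P.1 = c • (σ a).1) := by
  obtain ⟨c, s, hc, h⟩ := mem_pauliGroup_iff.mp hP
  refine ⟨c, hc, ?_⟩
  rcases Fin.eq_zero_or_eq_succ (s 0) with h0 | ⟨a, ha⟩
  · left
    have hs : s = 0 := funext fun i => by rw [Subsingleton.elim i 0, h0]; rfl
    rw [h, hs, pauliString_zero]
  · refine Or.inr ⟨a, ?_⟩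
    have hs : s = singleQubitIndex a := funext fun i => by rw [Subsingleton.elim i 0, ha]; rfl
    rw [h, hs, coe_singleQubitFrame_gate]

/-- The Clifford gate `(1 - iX - iY - iZ) / 2`, which permutes `X`, `Y`, `Z` cyclically. -/
noncomputable def cyclicGate : QGate 1 :=
  ⟨tensorMatrix fun _ => !![(1 - Complex.I) / 2, (-1 - Complex.I) / 2;
      (1 - Complex.I) / 2, (1 + Complex.I) / 2], by
    rw [Matrix.mem_unitaryGroup_iff, tensorMatrix_star, tensorMatrix_mul, ← tensorMatrix_one]
    congr 1
    funext i
    ext x y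
    fin_cases x <;> fin_cases y <;> simp [Matrix.mul_apply, Fin.sum_univ_two, Matrix.star_apply,
      Complex.conj_ofNat] <;> ring_nf <;> simp <;> norm_num⟩

theorem cyclicGate_conj (a : Fin 3) : cyclicGate * σ a * cyclicGate⁻¹ = σ (a + 1) := by
  rw [mul_inv_eq_iff_eq_mul]
  apply Subtype.ext
  rw [Submonoid.coe_mul, Submonoid.coe_mul, coe_singleQubitFrame_gate, coe_singleQubitFrame_gate,
    cyclicGate, pauliString, pauliString, tensorMatrix_mul, tensorMatrix_mul]
  congr 1
  funext i
  simp only [singleQubitIndex]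
  ext x y
  fin_cases a <;> fin_cases x <;> fin_cases y <;>
    simp [pauliMatrix, Matrix.mul_apply, Fin.sum_univ_two] <;> ring_nf <;> simp <;> ring

theorem cyclicGate_mem_normalizer :
    cyclicGate ∈ Subgroup.normalizer (pauliGroup 1 : Set (QGate 1)) := by
  rw [← mem_gateHierarchy_two]
  intro P hP
  obtain ⟨c, hc, h | ⟨a, h⟩⟩ := eq_smul_one_or_eq_smul_gate hP
  · have : cyclicGate * P * cyclicGate⁻¹ = P := by
      rw [mul_inv_eq_iff_eq_mul]
      apply Subtype.ext
      rw [Submonoid.coe_mul, Submonoid.coe_mul, h]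
      simp
    rwa [this]
  · refine mem_pauliGroup_of_eq_smul (c := c) (singleQubitFrame.gate_mem (a + 1)) ?_ ?_
    · rw [conj_pow, pow_four_of_mem_pauliGroup hP]
      group
    · rw [← cyclicGate_conj a]
      simp only [Submonoid.coe_mul, h, Matrix.mul_smul, Matrix.smul_mul]

theorem exists_clifford_conj_eq_gate (a : Fin 3) :
    ∃ A ∈ Subgroup.normalizer (pauliGroup 1 : Set (QGate 1)), A * σ 2 * A⁻¹ = σ a := by
  have h0 := cyclicGate_conj 2
  have h1 := cyclicGate_conj 0
  have hF := cyclicGate_mem_normalizer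
  fin_cases a
  · exact ⟨cyclicGate, hF, h0⟩
  · refine ⟨cyclicGate * cyclicGate, mul_mem hF hF, ?_⟩
    calc cyclicGate * cyclicGate * σ 2 * (cyclicGate * cyclicGate)⁻¹
        = cyclicGate * (cyclicGate * σ 2 * cyclicGate⁻¹) * cyclicGate⁻¹ := by group
      _ = σ 1 := by rw [h0]; exact h1
  · exact ⟨1, one_mem _, by simp⟩

/-! ### Diagonal one-qubit gates -/

theorem fin_one_ext {x y : Fin 1 → Fin 2} (h : x 0 = y 0) : x = y :=
  funext fun i => by rw [Subsingleton.elim i 0, h]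

/-- The gate `diag(1, z)`. -/
noncomputable def diagGate : Circle →* QGate 1 where
  toFun z := ⟨Matrix.diagonal fun x => if x 0 = 0 then 1 else (z : ℂ), by
    rw [Matrix.mem_unitaryGroup_iff, Matrix.star_eq_conjTranspose, Matrix.diagonal_conjTranspose,
      Matrix.diagonal_mul_diagonal, ← Matrix.diagonal_one]
    congr 1
    funext x
    rw [Pi.star_apply]
    split_ifs
    · simp
    · rw [Complex.star_def, Complex.mul_conj, Circle.normSq_coe, Complex.ofReal_one]⟩
  map_one' := by
    apply Subtype.ext
    simp
  map_mul' z w := by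
    apply Subtype.ext
    change Matrix.diagonal _ = Matrix.diagonal _ * Matrix.diagonal _
    rw [Matrix.diagonal_mul_diagonal]
    congr 1
    funext x
    split_ifs <;> simp

/-- The gate which multiplies by a global phase. -/
noncomputable def scalarGate (n : ℕ) : Circle →* QGate n where
  toFun z := ⟨(z : ℂ) • 1, by
    rw [Matrix.mem_unitaryGroup_iff, star_smul, star_one, Matrix.smul_mul, Matrix.mul_smul,
      smul_smul, Complex.star_def, Complex.mul_conj, Circle.normSq_coe, Complex.ofReal_one, one_smul,
      Matrix.one_mul]⟩
  map_one' := by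
    apply Subtype.ext
    simp
  map_mul' z w := by
    apply Subtype.ext
    change ((z * w : Circle) : ℂ) • (1 : Matrix (Fin n → Fin 2) (Fin n → Fin 2) ℂ) =
      ((z : ℂ) • 1) * ((w : ℂ) • 1)
    rw [Matrix.smul_mul, Matrix.mul_smul, smul_smul, Matrix.one_mul, Circle.coe_mul]

theorem coe_diagGate (z : Circle) :
    (diagGate z).1 = Matrix.diagonal fun x => if x 0 = 0 then 1 else (z : ℂ) :=
  rfl

theorem coe_scalarGate (n : ℕ) (z : Circle) : (scalarGate n z).1 = (z : ℂ) • 1 :=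
  rfl

theorem scalarGate_mul_comm {n : ℕ} (z : Circle) (U : QGate n) :
    scalarGate n z * U = U * scalarGate n z := by
  apply Subtype.ext
  simp [coe_scalarGate]

theorem scalarGate_mem_normalizer {n : ℕ} (z : Circle) :
    scalarGate n z ∈ Subgroup.normalizer (pauliGroup n : Set (QGate n)) := by
  intro P
  rw [scalarGate_mul_comm, mul_inv_cancel_right]

theorem pauliGroup_le_normalizer {n : ℕ} {P : QGate n} (hP : P ∈ pauliGroup n) :
    P ∈ Subgroup.normalizer (pauliGroup n : Set (QGate n)) :=
  Subgroup.le_normalizer hP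

theorem pauliGroup_subset_gateHierarchy {n : ℕ} (k : ℕ) {P : QGate n} (hP : P ∈ pauliGroup n) :
    P ∈ gateHierarchy n (k + 1) := by
  induction k generalizing P with
  | zero => exact hP
  | succ k ih => exact fun Q hQ => ih (mul_mem (mul_mem hP hQ) (inv_mem hP))

theorem mul_pauli_mem {n k : ℕ} {U P : QGate n} (hU : U ∈ gateHierarchy n (k + 1))
    (hP : P ∈ pauliGroup n) : U * P ∈ gateHierarchy n (k + 1) := by
  cases k with
  | zero => exact mul_mem (S := Subgroup (QGate n)) (s := pauliGroup n) hU hP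
  | succ k => exact mul_clifford_mem (pauliGroup_le_normalizer hP) hU

theorem clifford_mul_mem_iff {n k : ℕ} {L U : QGate n}
    (hL : L ∈ Subgroup.normalizer (pauliGroup n : Set (QGate n))) :
    L * U ∈ gateHierarchy n (k + 2) ↔ U ∈ gateHierarchy n (k + 2) :=
  ⟨fun h => by simpa using clifford_mul_mem (inv_mem hL) h, clifford_mul_mem hL⟩

theorem mul_clifford_mem_iff {n k : ℕ} {L U : QGate n}
    (hL : L ∈ Subgroup.normalizer (pauliGroup n : Set (QGate n))) :
    U * L ∈ gateHierarchy n (k + 2) ↔ U ∈ gateHierarchy n (k + 2) :=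
  ⟨fun h => by simpa using mul_clifford_mem (inv_mem hL) h, mul_clifford_mem hL⟩

theorem gateX_apply (x y : Fin 1 → Fin 2) :
    (σ 0).1 x y = if x 0 = y 0 then 0 else 1 := by
  rw [singleQubitFrame_gate_apply]
  generalize x 0 = i
  generalize y 0 = j
  fin_cases i <;> fin_cases j <;> simp [pauliMatrix]

theorem gateX_mul_self : σ 0 * σ 0 = 1 := by
  apply Subtype.ext
  rw [Submonoid.coe_mul, coe_singleQubitFrame_gate, pauliString_mul_self]
  rfl

theorem coe_gateZ :
    (σ 2).1 = Matrix.diagonal fun x => if x 0 = 0 then 1 else (-1 : ℂ) := by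
  ext x y
  rw [singleQubitFrame_gate_apply, Matrix.diagonal_apply]
  have hxy : x = y ↔ x 0 = y 0 := ⟨fun h => by rw [h], fin_one_ext⟩
  rw [if_congr hxy rfl rfl]
  generalize x 0 = i
  generalize y 0 = j
  fin_cases i <;> fin_cases j <;> simp [pauliMatrix]

theorem sum_fin_one_fin_two (f : (Fin 1 → Fin 2) → ℂ) :
    ∑ x, f x = f (fun _ => 0) + f (fun _ => 1) := by
  rw [← (Equiv.funUnique (Fin 1) (Fin 2)).symm.sum_comp, Fin.sum_univ_two]
  rfl

/-- `X diag(1, z) X = z diag(1, z⁻¹)`, written as a formula for the conjugate of `X`. -/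
theorem diagGate_conj_gateX (z : Circle) :
    diagGate z * σ 0 * (diagGate z)⁻¹ = σ 0 * scalarGate 1 z * diagGate (z⁻¹ * z⁻¹) := by
  rw [map_mul, map_inv, mul_inv_eq_iff_eq_mul, mul_assoc, mul_assoc (diagGate z)⁻¹,
    inv_mul_cancel, mul_one, ← map_inv]
  apply Subtype.ext
  ext x y
  rw [Submonoid.coe_mul, Submonoid.coe_mul, Submonoid.coe_mul, coe_diagGate, coe_diagGate,
    Matrix.diagonal_mul, Matrix.mul_diagonal, coe_scalarGate, Matrix.mul_smul, Matrix.mul_one,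
    Matrix.smul_apply, gateX_apply]
  generalize x 0 = i
  generalize y 0 = j
  fin_cases i <;> fin_cases j <;> simp

/-- A Pauli gate is diagonal, or becomes so after multiplication by `X`. -/
theorem exists_pauli_commute_diagGate {P : QGate 1} (hP : P ∈ pauliGroup 1) :
    ∃ Q ∈ pauliGroup 1, (∀ z, diagGate z * Q = Q * diagGate z) ∧ (P = Q ∨ P = σ 0 * Q) := by
  have hdiag : ∀ Q : QGate 1, (∀ x y, x 0 ≠ y 0 → Q.1 x y = 0) →
      ∀ z, diagGate z * Q = Q * diagGate z := by
    intro Q hQ z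
    apply Subtype.ext
    ext x y
    rw [Submonoid.coe_mul, Submonoid.coe_mul, coe_diagGate, Matrix.diagonal_mul,
      Matrix.mul_diagonal]
    by_cases hxy : x 0 = y 0
    · rw [hxy, mul_comm]
    · rw [hQ x y hxy, mul_zero, zero_mul]
  obtain ⟨c, hc, h | ⟨a, h⟩⟩ := eq_smul_one_or_eq_smul_gate hP
  · refine ⟨P, hP, hdiag P fun x y hxy => ?_, Or.inl rfl⟩
    rw [h, Matrix.smul_apply, Matrix.one_apply_ne fun h => hxy (by rw [h]), smul_zero]
  · by_cases ha : a = 2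
    · refine ⟨P, hP, hdiag P fun x y hxy => ?_, Or.inl rfl⟩
      rw [h, ha, Matrix.smul_apply, coe_gateZ, Matrix.diagonal_apply_ne _ fun h => hxy (by rw [h]),
        smul_zero]
    · refine ⟨σ 0 * P, mul_mem (singleQubitFrame.gate_mem 0) hP, hdiag _ fun x y hxy => ?_,
        Or.inr (by rw [← mul_assoc, gateX_mul_self, one_mul])⟩
      rw [Submonoid.coe_mul, h, Matrix.mul_smul, Matrix.smul_apply, Matrix.mul_apply,
        sum_fin_one_fin_two]
      simp only [singleQubitFrame_gate_apply]
      revert hxy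
      generalize x 0 = i
      generalize y 0 = j
      fin_cases a <;> fin_cases i <;> fin_cases j <;> simp [pauliMatrix] at ha ⊢

/-- For a diagonal gate only the conjugate of `X` has to be tested. -/
theorem diagGate_mem_add_two_iff (k : ℕ) (z : Circle) :
    diagGate z ∈ gateHierarchy 1 (k + 2) ↔
      σ 0 * scalarGate 1 z * diagGate (z⁻¹ * z⁻¹) ∈ gateHierarchy 1 (k + 1) := by
  rw [← diagGate_conj_gateX]
  refine ⟨fun h => h _ (singleQubitFrame.gate_mem 0), fun h P hP => ?_⟩
  obtain ⟨Q, hQ, hcomm, rfl | rfl⟩ := exists_pauli_commute_diagGate hP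
  · rw [hcomm, mul_inv_cancel_right]
    exact pauliGroup_subset_gateHierarchy k hQ
  · have := mul_pauli_mem h hQ
    convert this using 1
    rw [← mul_assoc, mul_assoc _ Q, mul_assoc _ _ Q, ← map_inv, ← hcomm]

theorem pow_four_of_pauli_entry {P : QGate 1} (hP : P ∈ pauliGroup 1) {x y : Fin 1 → Fin 2}
    (h : P.1 x y ≠ 0) : P.1 x y ^ 4 = 1 := by
  obtain ⟨c, hc, h1 | ⟨a, h1⟩⟩ := eq_smul_one_or_eq_smul_gate hP
  · rw [h1, Matrix.smul_apply, Matrix.one_apply] at h ⊢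
    split_ifs at h ⊢ with hxy
    · simpa using hc
    · simp at h
  · rw [h1, Matrix.smul_apply, singleQubitFrame_gate_apply, smul_eq_mul] at h ⊢
    rw [mul_pow, hc, one_mul]
    revert h
    generalize x 0 = i
    generalize y 0 = j
    have hI : (-Complex.I) ^ 4 = 1 := by rw [Even.neg_pow (by decide), Complex.I_pow_four]
    fin_cases a <;> fin_cases i <;> fin_cases j <;> simp [pauliMatrix, hI]
    norm_num

/-- The level of the diagonal gate `diag(1, z)` is determined by the order of `z`. -/
theorem diagGate_mem_gateHierarchy_iff (k : ℕ) (z : Circle) :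
    diagGate z ∈ gateHierarchy 1 (k + 2) ↔ z ^ 2 ^ (k + 2) = 1 := by
  induction k generalizing z with
  | zero =>
    rw [diagGate_mem_add_two_iff, mem_gateHierarchy_one]
    constructor
    · intro h
      have hent : (σ 0 * scalarGate 1 z * diagGate (z⁻¹ * z⁻¹)).1 (fun _ => 1) (fun _ => 0) = z := by
        rw [Submonoid.coe_mul, Submonoid.coe_mul, coe_diagGate, Matrix.mul_diagonal, coe_scalarGate,
          Matrix.mul_smul, Matrix.mul_one, Matrix.smul_apply, gateX_apply]
        simp
      have h4 := pow_four_of_pauli_entry h (by rw [hent]; exact z.coe_ne_zero)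
      rw [hent] at h4
      apply Circle.coe_injective
      simpa using h4
    · intro h
      have h4 : (z : ℂ) ^ 4 = 1 := by
        have := congrArg (fun w : Circle => (w : ℂ)) h
        simpa using this
      have hs : scalarGate 1 z ∈ pauliGroup 1 :=
        ⟨z, 0, h4, by rw [coe_scalarGate]; exact congrArg _ pauliString_zero.symm⟩
      refine mul_mem (mul_mem (singleQubitFrame.gate_mem 0) hs) ?_
      -- the square of a fourth root of unity is `1` or `-1`
      have hsq : ((z⁻¹ * z⁻¹ : Circle) : ℂ) * ((z⁻¹ * z⁻¹ : Circle) : ℂ) = 1 := by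
        have : (z⁻¹ * z⁻¹) * (z⁻¹ * z⁻¹) = (z ^ 4)⁻¹ := by group
        rw [← Circle.coe_mul, this]
        rw [show z ^ 4 = 1 from h]
        simp
      rcases mul_self_eq_one_iff.mp hsq with hw | hw
      · have : z⁻¹ * z⁻¹ = 1 := Circle.coe_injective hw
        rw [this, map_one]
        exact one_mem _
      · have : diagGate (z⁻¹ * z⁻¹) = σ 2 := by
          apply Subtype.ext
          rw [coe_diagGate, hw, coe_gateZ]
        rw [this]
        exact singleQubitFrame.gate_mem 2
  | succ k ih =>
    rw [diagGate_mem_add_two_iff, clifford_mul_mem_iff (mul_mem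
      (pauliGroup_le_normalizer (singleQubitFrame.gate_mem 0)) (scalarGate_mem_normalizer z)), ih]
    rw [← mul_inv, inv_pow, inv_eq_one, ← sq, ← pow_mul, ← pow_succ']

/-- Every one-qubit gate of the hierarchy is diagonal up to Clifford gates. -/
theorem exists_clifford_mul_diagGate_mul_clifford (k : ℕ) {U : QGate 1}
    (hU : U ∈ gateHierarchy 1 (k + 1)) :
    ∃ L₁ ∈ Subgroup.normalizer (pauliGroup 1 : Set (QGate 1)),
      ∃ L₂ ∈ Subgroup.normalizer (pauliGroup 1 : Set (QGate 1)),
        ∃ z, U = L₁ * diagGate z * L₂ := by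
  have hdiag : ∀ W : QGate 1, W.1 (fun _ => 0) (fun _ => 1) = 0 →
      W.1 (fun _ => 1) (fun _ => 0) = 0 →
      ∃ c z, W = scalarGate 1 c * diagGate z := by
    intro W h01 h10
    have hoff : ∀ x y, x ≠ y → W.1 x y = 0 := by
      intro x y hxy
      have h0 : x 0 ≠ y 0 := fun h => hxy (fin_one_ext h)
      rw [fin_one_ext (x := x) (y := fun _ => x 0) rfl, fin_one_ext (x := y) (y := fun _ => y 0) rfl]
      revert h0
      generalize x 0 = i
      generalize y 0 = j
      fin_cases i <;> fin_cases j <;> simp [h01, h10]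
    have hcircle : ∀ x, ∃ c : Circle, (c : ℂ) = W.1 x x := by
      intro x
      have h := sum_norm_sq_row W.2 x
      rw [Finset.sum_eq_single x (fun y _ hy => by simp [hoff x y hy.symm]) (by simp)] at h
      have h1 : ‖W.1 x x‖ = 1 := (pow_eq_one_iff_of_nonneg (norm_nonneg _) two_ne_zero).mp h
      exact ⟨⟨W.1 x x, mem_sphere_zero_iff_norm.mpr h1⟩, rfl⟩
    obtain ⟨c, hc⟩ := hcircle fun _ => 0
    obtain ⟨d, hd⟩ := hcircle fun _ => 1
    refine ⟨c, c⁻¹ * d, ?_⟩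
    apply Subtype.ext
    ext x y
    rw [Submonoid.coe_mul, coe_scalarGate, coe_diagGate, Matrix.smul_mul, Matrix.one_mul,
      Matrix.smul_apply, Matrix.diagonal_apply]
    split_ifs with hxy hx
    · rw [← hxy, fin_one_ext (x := x) (y := fun _ => 0) hx, ← hc]
      simp
    · rw [← hxy, fin_one_ext (x := x) (y := fun _ => 1) (Fin.eq_one_of_ne_zero _ hx), ← hd]
      simp
    · rw [hoff x y hxy, smul_zero]
  obtain ⟨a, b, c, h⟩ := exists_conj_singleQubitFrame_eq_smul k hU
  obtain ⟨A, hA, hA'⟩ := exists_clifford_conj_eq_gate a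
  obtain ⟨B, hB, hB'⟩ := exists_clifford_conj_eq_gate b
  set W := B⁻¹ * U * A with hW
  have hUW : U = B * W * A⁻¹ := by
    rw [hW]
    group
  -- `W` commutes with `Z` up to a scalar, hence it is diagonal or antidiagonal
  have hWZ : W.1 * (σ 2).1 = c • ((σ 2).1 * W.1) := by
    have h1 : W * σ 2 = B⁻¹ * (U * σ a * U⁻¹) * (B * W) := by
      rw [← hA', hW]
      group
    have h2 : σ 2 * W = B⁻¹ * σ b * (B * W) := by
      rw [← hB']
      group
    rw [← Submonoid.coe_mul, ← Submonoid.coe_mul, h1, h2]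
    simp only [Submonoid.coe_mul, h, Matrix.mul_smul, Matrix.smul_mul] at h ⊢
  have hent : ∀ x y, W.1 x y * (if y 0 = 0 then 1 else -1) =
      c * ((if x 0 = 0 then 1 else -1) * W.1 x y) := by
    intro x y
    have := congrFun (congrFun hWZ x) y
    rwa [coe_gateZ, Matrix.mul_diagonal, Matrix.smul_apply, Matrix.diagonal_mul] at this
  by_cases hc : c = 1
  · obtain ⟨d, z, hz⟩ := hdiag W
      (by have := hent (fun _ => 0) (fun _ => 1); rw [hc] at this; simpa [neg_eq_self] using this)
      (by have := hent (fun _ => 1) (fun _ => 0); rw [hc] at this; simpa [self_eq_neg] using this)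
    exact ⟨B * scalarGate 1 d, mul_mem hB (scalarGate_mem_normalizer d), A⁻¹, inv_mem hA, z, by
      rw [hUW, hz]; group⟩
  · have h00 : W.1 (fun _ => 0) (fun _ => 0) = 0 := by
      have := hent (fun _ => 0) (fun _ => 0)
      simp only [if_true, mul_one, one_mul] at this
      by_contra hne
      exact hc (mul_right_cancel₀ hne (by rw [one_mul, ← this]))
    have h11 : W.1 (fun _ => 1) (fun _ => 1) = 0 := by
      have := hent (fun _ => 1) (fun _ => 1)
      simp only [one_ne_zero, if_false, mul_neg, mul_one, neg_mul, one_mul, neg_inj] at this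
      by_contra hne
      exact hc (mul_right_cancel₀ hne (by rw [one_mul, ← this]))
    obtain ⟨d, z, hz⟩ := hdiag (σ 0 * W)
      (by simp [Matrix.mul_apply, sum_fin_one_fin_two, gateX_apply, h11])
      (by simp [Matrix.mul_apply, sum_fin_one_fin_two, gateX_apply, h00])
    exact ⟨B * (σ 0 * scalarGate 1 d), mul_mem hB (mul_mem
      (pauliGroup_le_normalizer (singleQubitFrame.gate_mem 0)) (scalarGate_mem_normalizer d)),
      A⁻¹, inv_mem hA, z, by
        have : W = σ 0 * (scalarGate 1 d * diagGate z) := by 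
          rw [← hz, ← mul_assoc, gateX_mul_self, one_mul]
        rw [hUW, this]
        group⟩

/-! ### The classification of one-qubit gates -/

/-- The primitive root of unity of order `2 ^ k` in the definition of the phase gate. -/
noncomputable def phaseRoot (k : ℕ) : Circle :=
  Circle.exp (2 * Real.pi / 2 ^ k)

theorem phaseGate_eq_diagGate (k : ℕ) : phaseGate k = diagGate (phaseRoot k) :=
  rfl

theorem isPrimitiveRoot_phaseRoot (k : ℕ) : IsPrimitiveRoot (phaseRoot k) (2 ^ k) := by
  have h := Complex.isPrimitiveRoot_exp (2 ^ k) (by positivity)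
  refine IsPrimitiveRoot.of_map_of_injective (f := Circle.coeHom) ?_ Circle.coe_injective
  convert h using 1
  change Complex.exp _ = _
  congr 1
  push_cast
  ring

theorem phaseGate_pow_mem_iff (k l m : ℕ) :
    phaseGate k ^ m ∈ gateHierarchy 1 (l + 2) ↔ 2 ^ k ∣ m * 2 ^ (l + 2) := by
  rw [phaseGate_eq_diagGate, ← map_pow, diagGate_mem_gateHierarchy_iff, ← pow_mul,
    (isPrimitiveRoot_phaseRoot k).pow_eq_one_iff_dvd]

theorem clifford_mul_phaseGate_mul_clifford_mem_iff {k l m : ℕ} {L₁ L₂ : QGate 1}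
    (h₁ : L₁ ∈ gateHierarchy 1 2) (h₂ : L₂ ∈ gateHierarchy 1 2) :
    L₁ * phaseGate k ^ m * L₂ ∈ gateHierarchy 1 (l + 2) ↔ 2 ^ k ∣ m * 2 ^ (l + 2) := by
  rw [mul_clifford_mem_iff (mem_gateHierarchy_two.mp h₂),
    clifford_mul_mem_iff (mem_gateHierarchy_two.mp h₁), phaseGate_pow_mem_iff]

theorem mem_gateHierarchy_iff_exists_phaseGate (k : ℕ) (U : QGate 1) :
    U ∈ gateHierarchy 1 (k + 2) ↔
      ∃ L₁ ∈ gateHierarchy 1 2, ∃ L₂ ∈ gateHierarchy 1 2, ∃ m : ℕ,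
        U = L₁ * phaseGate (k + 2) ^ m * L₂ := by
  constructor
  · intro hU
    obtain ⟨L₁, h₁, L₂, h₂, z, hz⟩ := exists_clifford_mul_diagGate_mul_clifford (k + 1) hU
    rw [hz, mul_clifford_mem_iff h₂, clifford_mul_mem_iff h₁, diagGate_mem_gateHierarchy_iff] at hU
    have hroot := (isPrimitiveRoot_phaseRoot (k + 2)).map_of_injective
      (f := Circle.coeHom) Circle.coe_injective
    have hzC : (z : ℂ) ^ 2 ^ (k + 2) = 1 := by
      rw [← Circle.coe_pow, hU, Circle.coe_one]
    obtain ⟨m, -, hm⟩ := hroot.eq_pow_of_pow_eq_one hzC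
    have hm' : phaseRoot (k + 2) ^ m = z := Circle.coe_injective hm
    refine ⟨L₁, mem_gateHierarchy_two.mpr h₁, L₂, mem_gateHierarchy_two.mpr h₂, m, ?_⟩
    rw [phaseGate_eq_diagGate, ← map_pow, hm', hz]
  · rintro ⟨L₁, h₁, L₂, h₂, m, rfl⟩
    rw [clifford_mul_phaseGate_mul_clifford_mem_iff h₁ h₂]
    exact dvd_mul_left _ _

theorem mem_and_notMem_gateHierarchy_iff_exists_phaseGate (k : ℕ) (U : QGate 1) :
    (U ∈ gateHierarchy 1 (k + 3) ∧ U ∉ gateHierarchy 1 (k + 2)) ↔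
      ∃ L₁ ∈ gateHierarchy 1 2, ∃ L₂ ∈ gateHierarchy 1 2, ∃ m : ℕ, Odd m ∧
        U = L₁ * phaseGate (k + 3) ^ m * L₂ := by
  have hodd : ∀ m : ℕ, ¬ 2 ^ (k + 3) ∣ m * 2 ^ (k + 2) ↔ Odd m := by
    intro m
    rw [pow_succ' 2 (k + 2), Nat.mul_dvd_mul_iff_right (by positivity), ← even_iff_two_dvd,
      Nat.not_even_iff_odd]
  rw [mem_gateHierarchy_iff_exists_phaseGate (k + 1)]
  constructor
  · rintro ⟨⟨L₁, h₁, L₂, h₂, m, rfl⟩, hnot⟩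
    rw [clifford_mul_phaseGate_mul_clifford_mem_iff h₁ h₂] at hnot
    exact ⟨L₁, h₁, L₂, h₂, m, (hodd m).mp hnot, rfl⟩
  · rintro ⟨L₁, h₁, L₂, h₂, m, hm, rfl⟩
    refine ⟨⟨L₁, h₁, L₂, h₂, m, rfl⟩, ?_⟩
    rw [clifford_mul_phaseGate_mul_clifford_mem_iff h₁ h₂]
    exact (hodd m).mpr hm

theorem theorem1 :
    -- for one and two qubits, every gate of every level of the hierarchy is semi-Clifford
    (∀ n : ℕ, n = 1 ∨ n = 2 → ∀ k : ℕ, 1 ≤ k → ∀ U ∈ gateHierarchy n k, IsSemiClifford U) ∧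
    -- the classification of the one-qubit gates of level `k`
    (∀ k : ℕ, 2 ≤ k → ∀ U : QGate 1,
      U ∈ gateHierarchy 1 k ↔
        ∃ L₁ ∈ gateHierarchy 1 2, ∃ L₂ ∈ gateHierarchy 1 2, ∃ m : ℕ,
          U = L₁ * phaseGate k ^ m * L₂) ∧
    -- the classification of the one-qubit gates of exact level `k`
    (∀ k : ℕ, 3 ≤ k → ∀ U : QGate 1,
      (U ∈ gateHierarchy 1 k ∧ U ∉ gateHierarchy 1 (k - 1)) ↔
        ∃ L₁ ∈ gateHierarchy 1 2, ∃ L₂ ∈ gateHierarchy 1 2, ∃ m : ℕ, Odd m ∧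
          U = L₁ * phaseGate k ^ m * L₂) := by
  refine ⟨fun n hn k hk U hU => ?_, fun k hk U => ?_, fun k hk U => ?_⟩
  · obtain ⟨k, rfl⟩ := Nat.exists_eq_add_of_le' hk
    rcases hn with rfl | rfl
    · exact isSemiClifford_of_mem_gateHierarchy_one_qubit k hU
    · exact isSemiClifford_of_mem_gateHierarchy_two_qubits k hU
  · obtain ⟨k, rfl⟩ := Nat.exists_eq_add_of_le' hk
    exact mem_gateHierarchy_iff_exists_phaseGate k U
  · obtain ⟨k, rfl⟩ := Nat.exists_eq_add_of_le' hk
    exact mem_and_notMem_gateHierarchy_iff_exists_phaseGate k U
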